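/- Let $n\ge 3$ and, for integers $i,j\ge 0$, put $$h_i=\frac{\sin\left(\pi(1+2i)/(2n)\right)}{\sin\left(\pi/(2n)\right)},\qquad v_j=\frac{\sin\left(\pi(1+j)/n\right)}{\sin\left(\pi/n\right)}.$$ **The surface.** For $0\le j\le\lfloor n/2\rfloor-1$ let $V_j$ be a rectangle of horizontal length $h_j$ and height $v_j$, and for $1\le i\le\lceil n/2\rceil-1$ let $H_i$ be a rectangle of horizontal length $h_i$ and height $v_{i-1}$. Let $\mathcal S$ be the translation surface obtained by gluing the right edge of $V_{i-1}$ to the left edge of $H_i$ and the top edge of $H_i$ to the bottom edge of $V_i$ (for all relevant $i$), and then identifying by translations the opposite edges of the resulting staircase (in each row the outer left and right edges, in each column the outer bottom and top edges). The corners of the rectangles are the vertices (cone points or marked points) of $\mathcal S$. A saddle connection is a straight line trajectory on $\mathcal S$ from a vertex to a vertex with no vertex in its interior; $\Lambda\subset\mathbb R^2$ denotes the set of holonomy vectors of saddle connections, which are also called saddle connections. **Winners and return time.** Let $$M_{x,y}=\begin{pmatrix}x&y\\0&x^{-1}\end{pmatrix},\qquad \Omega_1=\{(x,y)\in\mathbb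 R^2 : 0<x\le 1,\ 1-2(1+\cos(\pi/n))x<y\le 1\}.$$ A saddle connection $w\in\Lambda$ is a *winner* at $(x,y)\in\Omega_1$ if $M_{x,y}w$ has horizontal component in $(0,1]$ and positive slope, and its slope is at most that of $M_{x,y}w'$ for every $w'\in\Lambda$ such that $M_{x,y}w'$ has horizontal component in $(0,1]$ and positive slope. Let $\Gamma\subset SL_2(\mathbb R)$ be the Veech group of $\mathcal S$ (the derivatives of its affine automorphisms preserving the set of vertices), let $\Omega\subset SL_2(\mathbb R)/\Gamma$ be the set of all $g\Gamma$ such that $g\Lambda$ contains a vector $(r,0)$ with $0<r\le1$, and let $R(x,y)$ be the return time of the point $M_{x,y}\Gamma\in\Omega$ to $\Omega$ under the horocycle flow, i.e. the least $s>0$ with $\begin{pmatrix}1&0\\-s&1\end{pmatrix}M_{x,y}\Gamma\in\Omega$. **Regions.** Let $$P_1=\{(x,y)\in\Omega_1 : x+y>1\},\qquad P_n=\{(x,y)\in\Omega_1 : h_1x+y\le 1\},$$ and, for $2\le i\le n-1$, $$P_i=\{(x,y)\in\Omega_1 : xh_{i-2}+yv_{i-2}\le 1,\ xh_{i-1}+yv_{i-1}>1,\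 xh_1+y>1\}.$$ **Proposition.** The sets $P_1,\dots,P_n$ are nonempty, convex and pairwise disjoint, and their union is $\Omega_1$. Moreover: 1. At every point of $P_1$ the vector $(0,1)$, which forms the vertical edge of $V_0$, is a winner, and the return time exists and is $R(x,y)=\dfrac1{xy}$. 2. For $2\le i\le n-1$, at every point of $P_i$ the vector $(h_{i-2},v_{i-2})=(h_{n+1-i},v_{n-i})$ is a winner. It is the positive-sloped diagonal of $V_{i-2}$ if $i\le\lfloor n/2\rfloor+1$, and the positive-sloped diagonal of $H_{n+1-i}$ if $i\ge\lfloor n/2\rfloor+2$. The return time exists and is $$R(x,y)=\frac{v_{i-2}}{x(h_{i-2}x+v_{i-2}y)}.$$ 3. At every point of $P_n$ the vector $(h_1,v_0)$, which is the positive-sloped diagonal of $H_1$, is a winner, and the return time exists and is $$R(x,y)=\frac{v_0}{x(h_1x+v_0y)}.$$ -/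

import Mathlib

open Matrix

namespace Staircase

noncomputable section

/-- The horizontal side lengths `h_i = csc (π / 2n) sin (π (1 + 2i) / 2n)`. -/
def h (n i : ℕ) : ℝ :=
  Real.sin (Real.pi * (1 + 2 * i) / (2 * n)) / Real.sin (Real.pi / (2 * n))

/-- The vertical side lengths `v_j = csc (π / n) sin (π (1 + j) / n)`. -/
def v (n j : ℕ) : ℝ :=
  Real.sin (Real.pi * (1 + j) / n) / Real.sin (Real.pi / n)

/-- The rectangles of the staircase: `V_j` for `0 ≤ j ≤ ⌊n/2⌋ - 1` and `H_i` for
`1 ≤ i ≤ ⌈n/2⌉ - 1`. -/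
inductive Tile (n : ℕ) : Type
  | V (j : ℕ) (hj : j < n / 2) : Tile n
  | H (i : ℕ) (hi : 1 ≤ i ∧ i < (n + 1) / 2) : Tile n

namespace Tile

variable {n : ℕ}

/-- Horizontal length of a rectangle: `h_j` for `V_j`, and `h_i` for `H_i`. -/
def width : Tile n → ℝ
  | V j _ => h n j
  | H i _ => h n i

/-- Height of a rectangle: `v_j` for `V_j`, and `v_{i-1}` for `H_i`. -/
def height : Tile n → ℝ
  | V j _ => v n j
  | H i _ => v n (i - 1)

/-- The vector from the lower left to the upper right vertex. -/
def diagonal (T : Tile n) : Fin 2 → ℝ := ![T.width, T.height]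

/-- The vertical edge, as a vector pointing up. -/
def verticalEdge (T : Tile n) : Fin 2 → ℝ := ![0, T.height]

/-- The rectangle whose left edge is glued to the right edge of the given one. The right edge of
`V_j` is glued to the left edge of `H_{j+1}`, if that exists; in each row the outer left and right
edges, being opposite edges of the staircase, are glued to each other. -/
def right : Tile n → Tile n
  | V j hj => if hj' : j + 1 < (n + 1) / 2 then H (j + 1) ⟨by omega, hj'⟩ else V j hj
  | H i hi => V (i - 1) (by omega)

/-- The rectangle whose bottom edge is glued to the top edge of the given one. The top edge of
`H_i` is glued to the bottom edge of `V_i`, if that exists; in each column the outer top and bottom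
edges, being opposite edges of the staircase, are glued to each other. -/
def up : Tile n → Tile n
  | V j hj => if hj' : 1 ≤ j then H j ⟨hj', by omega⟩ else V j hj
  | H i hi => if hi' : i < n / 2 then V i hi' else H i hi

/-- The closed rectangle `[0, width] × [0, height]`. -/
def carrier (T : Tile n) : Set (Fin 2 → ℝ) :=
  {p | p 0 ∈ Set.Icc 0 T.width ∧ p 1 ∈ Set.Icc 0 T.height}

end Tile

/-- A point of the disjoint union of the closed rectangles. -/
structure TilePoint (n : ℕ) where
  tile : Tile n
  pos : Fin 2 → ℝ
  mem : pos ∈ tile.carrier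

/-- `P` lies on a right (or top) edge, and `Q` is the corresponding point of the left (or bottom)
edge to which it is glued by a translation. -/
def Glue (n : ℕ) (P Q : TilePoint n) : Prop :=
  (Q.tile = P.tile.right ∧ P.pos 0 = P.tile.width ∧ Q.pos 0 = 0 ∧ Q.pos 1 = P.pos 1) ∨
  (Q.tile = P.tile.up ∧ P.pos 1 = P.tile.height ∧ Q.pos 1 = 0 ∧ Q.pos 0 = P.pos 0)

/-- The staircase surface `𝒮`: the rectangles, glued along their edges. -/
def Surface (n : ℕ) : Type := Quot (Glue n)

/-- The point of the surface with coordinates `p` in the rectangle `T`. -/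
def Surface.mk {n : ℕ} (T : Tile n) (p : Fin 2 → ℝ) (hp : p ∈ T.carrier) : Surface n :=
  Quot.mk (Glue n) ⟨T, p, hp⟩

/-- The vertices (cone points, or marked points when the cone angle is `2π`) of the surface: the
images of the corners of the rectangles. -/
def IsVertex {n : ℕ} (z : Surface n) : Prop :=
  ∃ (T : Tile n) (p : Fin 2 → ℝ) (hp : p ∈ T.carrier),
    (p 0 = 0 ∨ p 0 = T.width) ∧ (p 1 = 0 ∨ p 1 = T.height) ∧ z = Surface.mk T p hp

/-- `Straight w t a b`: a straight line trajectory of constant velocity `w` leads in time `t > 0`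
from `a` to `b`, without passing through a vertex strictly in between. It is a concatenation of
segments inside rectangles (whose relative interior contains no corner) at points which are not
vertices. -/
inductive Straight {n : ℕ} (w : Fin 2 → ℝ) : ℝ → Surface n → Surface n → Prop
  | segment (T : Tile n) (p : Fin 2 → ℝ) (t : ℝ) (ht : 0 < t) (hp : p ∈ T.carrier)
      (hq : p + t • w ∈ T.carrier) :
      Straight w t (Surface.mk T p hp) (Surface.mk T (p + t • w) hq)
  | trans (s t : ℝ) (a b c : Surface n) (hab : Straight w s a b) (hb : ¬ IsVertex b)
      (hbc : Straight w t b c) : Straight w (s + t) a c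

/-- The set `Λ_sc(𝒮)` of holonomy vectors of saddle connections. -/
def saddleConnections (n : ℕ) : Set (Fin 2 → ℝ) :=
  {w | w ≠ 0 ∧ ∃ a b : Surface n, IsVertex a ∧ IsVertex b ∧ Straight w 1 a b}

/-- The linear action of `SL₂(ℝ)` on the plane. -/
def act (g : SpecialLinearGroup (Fin 2) ℝ) (w : Fin 2 → ℝ) : Fin 2 → ℝ :=
  (g : Matrix (Fin 2) (Fin 2) ℝ) *ᵥ w

theorem act_one (w : Fin 2 → ℝ) : act 1 w = w := by
  simp [act]

theorem act_mul (g g' : SpecialLinearGroup (Fin 2) ℝ) (w : Fin 2 → ℝ) :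
    act (g * g') w = act g (act g' w) := by
  simp [act, ← mulVec_mulVec]

/-- `φ` is an affine automorphism of the surface (preserving the set of vertices) with derivative
`A`: it maps straight line trajectories of velocity `w` to those of velocity `A w`. -/
def IsAffineAut {n : ℕ} (A : SpecialLinearGroup (Fin 2) ℝ) (φ : Surface n ≃ Surface n) : Prop :=
  (∀ a, IsVertex (φ a) ↔ IsVertex a) ∧
  ∀ (w : Fin 2 → ℝ) (t : ℝ) (a b : Surface n),
    Straight (act A w) t (φ a) (φ b) ↔ Straight w t a b

/-- The Veech group of `𝒮`: the derivatives of its affine automorphisms, that is, the stabilizer of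
`𝒮` in `SL₂(ℝ)`. -/
def veechGroup (n : ℕ) : Subgroup (SpecialLinearGroup (Fin 2) ℝ) where
  carrier := {A | ∃ φ : Surface n ≃ Surface n, IsAffineAut A φ}
  one_mem' := ⟨Equiv.refl _, by simp [IsAffineAut, act_one]⟩
  mul_mem' := by
    rintro A B ⟨φ, hφ, hφ'⟩ ⟨ψ, hψ, hψ'⟩
    refine ⟨ψ.trans φ, fun a => by simp [hφ, hψ], fun w t a b => ?_⟩
    rw [act_mul, Equiv.trans_apply, Equiv.trans_apply, hφ', hψ']
  inv_mem' := by
    rintro A ⟨φ, hφ, hφ'⟩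
    refine ⟨φ.symm, fun a => by rw [← hφ]; simp, fun w t a b => ?_⟩
    rw [← hφ', ← act_mul]
    simp [act_one]

/-- The matrix `M_{x,y}`. -/
def M (x y : ℝ) (hx : 0 < x) : SpecialLinearGroup (Fin 2) ℝ :=
  ⟨!![x, y; 0, x⁻¹], by simp [det_fin_two, hx.ne']⟩

/-- The horocycle flow `h_s`. -/
def horocycle (s : ℝ) : SpecialLinearGroup (Fin 2) ℝ :=
  ⟨!![1, 0; -s, 1], by simp [det_fin_two]⟩

/-- The Poincaré section `Ω ⊆ SL₂(ℝ)/Γ`: all `gΓ` such that `g Λ_sc(𝒮)` meets `(0, 1]`, seen as a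
subset of the real axis. -/
def poincareSection (n : ℕ) : Set (SpecialLinearGroup (Fin 2) ℝ ⧸ veechGroup n) :=
  {X | ∃ g : SpecialLinearGroup (Fin 2) ℝ, X = (g : SpecialLinearGroup (Fin 2) ℝ ⧸ veechGroup n) ∧
    ∃ w ∈ saddleConnections n, act g w 0 ∈ Set.Ioc (0 : ℝ) 1 ∧ act g w 1 = 0}

/-- `r` is the return time of the point `X` of the section: the first positive time at which the
horocycle orbit of `X` meets the section again. -/
def IsReturnTime (n : ℕ) (X : SpecialLinearGroup (Fin 2) ℝ ⧸ veechGroup n) (r : ℝ) : Prop :=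
  X ∈ poincareSection n ∧ IsLeast {s : ℝ | 0 < s ∧ horocycle s • X ∈ poincareSection n} r

/-- The slope of a plane vector (used for vectors with positive horizontal component only). -/
def slope (w : Fin 2 → ℝ) : ℝ := w 1 / w 0

/-- The image of `w` under `g` has horizontal component in `(0, 1]` and positive slope. -/
def IsCandidate (g : SpecialLinearGroup (Fin 2) ℝ) (w : Fin 2 → ℝ) : Prop :=
  act g w 0 ∈ Set.Ioc (0 : ℝ) 1 ∧ 0 < slope (act g w)

/-- `w` is a winning saddle connection at `(x, y)`, where `g = M_{x,y}`. -/
def IsWinner (n : ℕ) (g : SpecialLinearGroup (Fin 2) ℝ) (w : Fin 2 → ℝ) : Prop :=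
  w ∈ saddleConnections n ∧ IsCandidate g w ∧
    ∀ w' ∈ saddleConnections n, IsCandidate g w' → slope (act g w) ≤ slope (act g w')

/-- The triangle `Ω₁`. -/
def Omega1 (n : ℕ) : Set (ℝ × ℝ) :=
  {z | 0 < z.1 ∧ z.1 ≤ 1 ∧ 1 - 2 * (1 + Real.cos (Real.pi / n)) * z.1 < z.2 ∧ z.2 ≤ 1}

/-- The regions `P_1, …, P_n`. -/
def P (n i : ℕ) : Set (ℝ × ℝ) :=
  if i = 1 then {z | z ∈ Omega1 n ∧ z.1 + z.2 > 1}
  else if i = n then {z | z ∈ Omega1 n ∧ h n 1 * z.1 + z.2 ≤ 1}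
  else {z | z ∈ Omega1 n ∧ z.1 * h n (i - 2) + z.2 * v n (i - 2) ≤ 1 ∧
    z.1 * h n (i - 1) + z.2 * v n (i - 1) > 1 ∧ z.1 * h n 1 + z.2 > 1}

end

end Staircase

namespace Staircase

/-! ### Trigonometric identities -/

/-! Put d_i = (h_i, v_i) and ℓ(a, b) = xa + yb. The vector M_{x,y}(a, b) is (ℓ(a, b), b/x), so among
vectors with b > 0 and ℓ > 0 a smaller slope means a direction further clockwise. A saddle
connection w with positive height and 0 < ℓ(w) ≤ 1 therefore wins as soon as ℓ > 1 on every saddle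
connection of positive height clockwise of w. The return time is the slope of the winner, because
the horocycle flow makes a vector horizontal exactly at the time equal to its slope.

The vectors d_0 = (1, 1), d_1, ..., d_{n-2} = (h_1, 1), d_{n-1} = (1, 0) turn clockwise, and
consecutive ones span area one (`cross_diagonals`). A saddle connection has cross product zero or at
least one in absolute value with each d_i (`one_le_abs_cross`). Indeed, all rectangle sides are at
least one, so nonzero coordinates of saddle connections are at least one in absolute value; and the
multitwists along rows and columns, which preserve the set of saddle connections, combine to a map
sending d_{i+1} to -d_i. Only this preservation is needed, not that the shears lie in the Veech
group. Hence a saddle connection in the cone of d_k and d_{k+1} is a combination of the two whose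
nonzero coefficients are at least one, which bounds ℓ from below (`one_lt_of_clockwise`).

The numbers ℓ(d_j) are samples of a sinusoid in j with frequency π/n. If two of them are at least
one, those strictly between exceed one (`one_lt_between`). So once ℓ(d_{n-2}) > 1, the indices up to
n - 2 with ℓ(d_j) > 1 form a final segment, and the regions record where it starts. -/

theorem sin_le_sin_of_le_pi_sub {a x : ℝ} (ha : 0 ≤ a) (hax : a ≤ x) (hx : x ≤ Real.pi - a) :
    Real.sin a ≤ Real.sin x := by
  rcases le_total x (Real.pi / 2) with h | h
  · exact Real.sin_le_sin_of_le_of_le_pi_div_two (by linarith [Real.pi_pos]) h hax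
  · rw [← Real.sin_pi_sub x]
    exact Real.sin_le_sin_of_le_of_le_pi_div_two (by linarith [Real.pi_pos]) (by linarith)
      (by linarith)

theorem sin_pi_div_two_mul_pos {n : ℕ} (hn : 2 ≤ n) : 0 < Real.sin (Real.pi / (2 * n)) := by
  have hn' : (2 : ℝ) ≤ n := by exact_mod_cast hn
  apply Real.sin_pos_of_pos_of_lt_pi
  · positivity
  · exact div_lt_self Real.pi_pos (by linarith)

theorem sin_pi_div_pos {n : ℕ} (hn : 2 ≤ n) : 0 < Real.sin (Real.pi / n) := by
  have hn' : (2 : ℝ) ≤ n := by exact_mod_cast hn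
  apply Real.sin_pos_of_pos_of_lt_pi
  · positivity
  · exact div_lt_self Real.pi_pos (by linarith)

theorem one_le_h {n i : ℕ} (hn : 2 ≤ n) (hi : i + 1 ≤ n) : 1 ≤ h n i := by
  have hn' : (2 : ℝ) ≤ n := by exact_mod_cast hn
  have hi' : (i : ℝ) + 1 ≤ n := by exact_mod_cast hi
  rw [h, one_le_div (sin_pi_div_two_mul_pos hn)]
  have e : Real.pi * (1 + 2 * i) / (2 * n) = (1 + 2 * i) * (Real.pi / (2 * n)) := by ring
  have e' : Real.pi - Real.pi / (2 * n) = (2 * n - 1) * (Real.pi / (2 * n)) := by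
    field_simp
  have hp : 0 < Real.pi / (2 * n) := by positivity
  apply sin_le_sin_of_le_pi_sub hp.le
  · rw [e]
    nlinarith [(Nat.cast_nonneg i : (0 : ℝ) ≤ i)]
  · rw [e, e']
    exact mul_le_mul_of_nonneg_right (by linarith) hp.le

theorem one_le_v {n j : ℕ} (hj : j + 2 ≤ n) : 1 ≤ v n j := by
  have hn' : (2 : ℝ) ≤ n := by exact_mod_cast (show 2 ≤ n by omega)
  have hi' : (j : ℝ) + 2 ≤ n := by exact_mod_cast hj
  rw [v, one_le_div (sin_pi_div_pos (by omega))]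
  have e : Real.pi * (1 + j) / n = (1 + j) * (Real.pi / n) := by ring
  have e' : Real.pi - Real.pi / n = (n - 1) * (Real.pi / n) := by
    field_simp
  have hp : 0 < Real.pi / n := by positivity
  apply sin_le_sin_of_le_pi_sub hp.le
  · rw [e]
    nlinarith [(Nat.cast_nonneg j : (0 : ℝ) ≤ j)]
  · rw [e, e']
    exact mul_le_mul_of_nonneg_right (by linarith) hp.le

theorem h_symm {n i j : ℕ} (hij : i + j + 1 = n) : h n i = h n j := by
  have hn : (n : ℝ) = i + j + 1 := by exact_mod_cast hij.symm
  have h0 : (i : ℝ) + j + 1 ≠ 0 := by positivity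
  rw [h, h, ← Real.sin_pi_sub (Real.pi * (1 + 2 * i) / (2 * n)), hn]
  congr 2
  field_simp
  ring

theorem v_symm {n i j : ℕ} (hij : i + j + 2 = n) : v n i = v n j := by
  have hn : (n : ℝ) = i + j + 2 := by exact_mod_cast hij.symm
  have h0 : (i : ℝ) + j + 2 ≠ 0 := by positivity
  rw [v, v, ← Real.sin_pi_sub (Real.pi * (1 + i) / n), hn]
  congr 2
  field_simp
  ring

theorem h_zero {n : ℕ} (hn : 2 ≤ n) : h n 0 = 1 := by
  simp [h, (sin_pi_div_two_mul_pos hn).ne']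

theorem v_zero {n : ℕ} (hn : 2 ≤ n) : v n 0 = 1 := by
  simp [v, (sin_pi_div_pos hn).ne']

theorem v_last {n : ℕ} (hn : 1 ≤ n) : v n (n - 1) = 0 := by
  have : (n : ℝ) ≠ 0 := by positivity
  rw [v, Nat.cast_sub hn, show Real.pi * (1 + ((n : ℝ) - (1 : ℕ))) / n = Real.pi by
    field_simp; simp]
  simp

/-- The modulus of the rows of the staircase. -/
noncomputable def rowModulus (n : ℕ) : ℝ := 2 * (1 + Real.cos (Real.pi / n))

/-- This and `v_add_v_succ` play two roles: they compute the circumferences of rows and columns, and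
they form the recurrence leading from one diagonal to the next. -/
theorem h_add_h_succ {n : ℕ} (hn : 2 ≤ n) (i : ℕ) :
    h n i + h n (i + 1) = rowModulus n * v n i := by
  have hn' : (n : ℝ) ≠ 0 := by positivity
  have h2 := (sin_pi_div_pos hn).ne'
  have h1 := (sin_pi_div_two_mul_pos hn).ne'
  have e : Real.pi / n = 2 * (Real.pi / (2 * n)) := by field_simp
  rw [e] at h2
  rw [h, h, v, rowModulus, e,
    show Real.pi * (1 + 2 * i) / (2 * n) = Real.pi * (1 + i) / n - Real.pi / (2 * n) by
      field_simp; ring,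
    show Real.pi * (1 + 2 * (i + 1 : ℕ)) / (2 * n) = Real.pi * (1 + i) / n + Real.pi / (2 * n) by
      push_cast; field_simp; ring, Real.sin_sub, Real.sin_add, Real.cos_two_mul]
  rw [Real.sin_two_mul] at h2 ⊢
  generalize Real.pi / (2 * n) = a at *
  generalize Real.pi * (1 + i) / n = b at *
  have h3 : Real.cos a ≠ 0 := fun h => h2 (by rw [h]; simp)
  field_simp
  ring

theorem v_add_v_succ {n : ℕ} (hn : 2 ≤ n) (i : ℕ) : v n i + v n (i + 1) = h n (i + 1) := by
  have hn' : (n : ℝ) ≠ 0 := by positivity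
  have h2 := (sin_pi_div_pos hn).ne'
  have h1 := (sin_pi_div_two_mul_pos hn).ne'
  have e : Real.pi / n = 2 * (Real.pi / (2 * n)) := by field_simp
  rw [e] at h2
  set a := Real.pi / (2 * n) with ha
  rw [h, v, v, e,
    show Real.pi * (1 + 2 * (i + 1 : ℕ)) / (2 * n) = Real.pi * (3 + 2 * i) / (2 * n) by
      push_cast; ring,
    show Real.pi * (1 + i) / n = Real.pi * (3 + 2 * i) / (2 * n) - a by
      rw [ha]; field_simp; ring,
    show Real.pi * (1 + (i + 1 : ℕ)) / n = Real.pi * (3 + 2 * i) / (2 * n) + a by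
      rw [ha]; push_cast; field_simp; ring, Real.sin_sub, Real.sin_add]
  rw [Real.sin_two_mul] at h2 ⊢
  rw [← ha]
  have h3 : Real.cos a ≠ 0 := fun h => h2 (by rw [h]; simp)
  field_simp
  ring

/-- Consecutive diagonals span a parallelogram of area one. -/
theorem cross_diagonals {n : ℕ} (hn : 2 ≤ n) (i : ℕ) :
    h n (i + 1) * v n i - v n (i + 1) * h n i = 1 := by
  induction i with
  | zero =>
    have := v_add_v_succ hn 0
    rw [h_zero hn, v_zero hn] at *
    linarith
  | succ i ih =>
    have h1 := v_add_v_succ hn i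
    have h2 := v_add_v_succ hn (i + 1)
    have h3 := h_add_h_succ hn i
    have h4 := h_add_h_succ hn (i + 1)
    -- The recurrence is a linear map of determinant one, so it preserves the cross product.
    rw [← ih, show h n (i + 1 + 1) = rowModulus n * v n (i + 1) - h n (i + 1) by linarith,
      show v n (i + 1 + 1) = h n (i + 1 + 1) - v n (i + 1) by linarith,
      show h n (i + 1 + 1) = rowModulus n * v n (i + 1) - h n (i + 1) by linarith]
    have h5 : h n i = rowModulus n * v n i - h n (i + 1) := by linarith
    have h6 : v n i = h n (i + 1) - v n (i + 1) := by linarith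
    rw [h5, h6]
    ring

/-- The linear functional `(x, y)` on the diagonals, as a function of the index, is a combination
of sines. -/
theorem sin_interpolation {n : ℕ} (hn : 2 ≤ n) (x y : ℝ) (i p q : ℕ) :
    Real.sin ((p + q) * (Real.pi / n)) * (x * h n (i + p) + y * v n (i + p)) =
      Real.sin (q * (Real.pi / n)) * (x * h n i + y * v n i) +
      Real.sin (p * (Real.pi / n)) * (x * h n (i + p + q) + y * v n (i + p + q)) := by
  have hn' : (n : ℝ) ≠ 0 := by positivity
  have key (A B t : ℝ) : Real.sin (A + B) * Real.sin t =
      Real.sin B * Real.sin (t - A) + Real.sin A * Real.sin (t + B) := by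
    simp only [Real.sin_add, Real.sin_sub]
    ring
  have hh := key (p * (Real.pi / n)) (q * (Real.pi / n))
    (Real.pi * (1 + 2 * (i + p)) / (2 * n))
  have hv := key (p * (Real.pi / n)) (q * (Real.pi / n)) (Real.pi * (1 + (i + p)) / n)
  rw [show Real.pi * (1 + 2 * (i + p)) / (2 * n) - p * (Real.pi / n) =
      Real.pi * (1 + 2 * i) / (2 * n) by field_simp; ring,
    show Real.pi * (1 + 2 * (i + p)) / (2 * n) + q * (Real.pi / n) =
      Real.pi * (1 + 2 * (i + p + q)) / (2 * n) by field_simp; ring, ← add_mul] at hh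
  rw [show Real.pi * (1 + (i + p)) / n - p * (Real.pi / n) =
      Real.pi * (1 + i) / n by field_simp; ring,
    show Real.pi * (1 + (i + p)) / n + q * (Real.pi / n) =
      Real.pi * (1 + (i + p + q)) / n by field_simp; ring, ← add_mul] at hv
  simp only [h, v]
  push_cast
  linear_combination (x / Real.sin (Real.pi / (2 * n))) * hh + (y / Real.sin (Real.pi / n)) * hv

theorem sin_mul_pi_div_pos {n p : ℕ} (hp : 0 < p) (hpn : p < n) :
    0 < Real.sin (p * (Real.pi / n)) := by
  have hp' : (0 : ℝ) < p := by exact_mod_cast hp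
  have hn' : (p : ℝ) < n := by exact_mod_cast hpn
  apply Real.sin_pos_of_pos_of_lt_pi
  · have : (0 : ℝ) < n := by linarith
    positivity
  · rw [← mul_div_assoc, div_lt_iff₀ (by linarith), mul_comm]
    exact mul_lt_mul_of_pos_left hn' Real.pi_pos

/-- Strict subadditivity of sine makes the weights in `sin_interpolation` add up to more than one.
-/
theorem sin_add_mul_lt {n p q : ℕ} (hp : 0 < p) (hq : 0 < q) (hpq : p + q < n) :
    Real.sin ((p + q) * (Real.pi / n)) <
      Real.sin (q * (Real.pi / n)) + Real.sin (p * (Real.pi / n)) := by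
  have h1 := sin_mul_pi_div_pos hp (show p < n by omega)
  have h2 := sin_mul_pi_div_pos hq (show q < n by omega)
  rw [add_mul, Real.sin_add]
  have h3 : Real.cos (p * (Real.pi / n)) < 1 := by
    nlinarith [Real.sin_sq_add_cos_sq (p * (Real.pi / n))]
  nlinarith [Real.cos_le_one (q * (Real.pi / n))]

theorem sin_mul_eq_v {n : ℕ} (hn : 2 ≤ n) (j : ℕ) :
    Real.sin ((j + 1 : ℕ) * (Real.pi / n)) = v n j * Real.sin (Real.pi / n) := by
  rw [v, div_mul_cancel₀ _ (sin_pi_div_pos hn).ne']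
  congr 1
  push_cast
  ring

/-- A linear functional which is at least one on two diagonals exceeds one on those strictly
between. -/
theorem one_lt_between {n : ℕ} (x y : ℝ) {i j m : ℕ} (hij : i < j) (hjm : j < m)
    (hm : m < n) (h1 : 1 ≤ x * h n i + y * v n i) (h2 : 1 ≤ x * h n m + y * v n m) :
    1 < x * h n j + y * v n j := by
  obtain ⟨p, rfl⟩ := Nat.exists_eq_add_of_lt hij
  obtain ⟨q, rfl⟩ := Nat.exists_eq_add_of_lt hjm
  have key := sin_interpolation (show 2 ≤ n by omega) x y i (p + 1) (q + 1)
  have hlt := sin_add_mul_lt (n := n) (show 0 < p + 1 by omega) (show 0 < q + 1 by omega)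
    (by omega)
  have hp := sin_mul_pi_div_pos (show 0 < p + 1 by omega) (show p + 1 < n by omega)
  have hq := sin_mul_pi_div_pos (show 0 < q + 1 by omega) (show q + 1 < n by omega)
  have hpq := sin_mul_pi_div_pos (show 0 < (p + 1) + (q + 1) by omega)
    (show (p + 1) + (q + 1) < n by omega)
  rw [Nat.cast_add] at hpq
  simp only [← add_assoc] at key h2 ⊢
  set S := Real.sin (((p + 1 : ℕ) + (q + 1 : ℕ) : ℝ) * (Real.pi / n))
  nlinarith

end Staircase

namespace Staircase

/-! ### The rectangles and their neighbours -/

namespace Tile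

variable {n : ℕ}

/-- The rectangle glued to the right (`k = 0`) or to the top (`k = 1`) of the given one. -/
def next (k : Fin 2) (T : Tile n) : Tile n := if k = 0 then T.right else T.up

theorem right_right (T : Tile n) : T.right.right = T := by
  cases T with
  | V j hj =>
    by_cases hj' : j + 1 < (n + 1) / 2
    · simp [right, hj']
    · simp [right, hj']
  | H i hi =>
    obtain ⟨i, rfl⟩ := Nat.exists_eq_add_of_le' hi.1
    simp [right, hi.2]

theorem up_up (T : Tile n) : T.up.up = T := by
  cases T with
  | V j hj =>
    by_cases hj' : 1 ≤ j
    · simp [up, hj', hj]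
    · simp [up, hj']
  | H i hi =>
    by_cases hi' : i < n / 2
    · simp [up, hi', hi.1]
    · simp [up, hi']

/-- Each row and each column consists of one or two rectangles. -/
theorem next_next (k : Fin 2) (T : Tile n) : (T.next k).next k = T := by
  unfold next
  split_ifs
  · exact right_right T
  · exact up_up T

theorem height_right (T : Tile n) : T.right.height = T.height := by
  cases T with
  | V j hj => by_cases hj' : j + 1 < (n + 1) / 2 <;> simp [right, hj', height]
  | H i hi => simp [right, height]

theorem width_up (T : Tile n) : T.up.width = T.width := by
  cases T with
  | V j hj => by_cases hj' : 1 ≤ j <;> simp [up, hj', width]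
  | H i hi => by_cases hi' : i < n / 2 <;> simp [up, hi', width]

theorem diagonal_next {k l : Fin 2} (hkl : k ≠ l) (T : Tile n) :
    (T.next k).diagonal l = T.diagonal l := by
  fin_cases k <;> fin_cases l
  · exact absurd rfl hkl
  · exact height_right T
  · exact width_up T
  · exact absurd rfl hkl

theorem one_le_width (T : Tile n) : 1 ≤ T.width := by
  cases T with
  | V j hj => exact one_le_h (by omega) (by omega)
  | H i hi => exact one_le_h (by omega) (by omega)

theorem one_le_height (T : Tile n) : 1 ≤ T.height := by
  cases T with
  | V j hj => exact one_le_v (by omega)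
  | H i hi => exact one_le_v (by omega)

theorem one_le_diagonal (T : Tile n) (k : Fin 2) : 1 ≤ T.diagonal k := by
  fin_cases k
  · exact T.one_le_width
  · exact T.one_le_height

theorem diagonal_pos (T : Tile n) (k : Fin 2) : 0 < T.diagonal k :=
  one_pos.trans_le (T.one_le_diagonal k)

theorem mem_carrier_iff {T : Tile n} {p : Fin 2 → ℝ} :
    p ∈ T.carrier ↔ ∀ i, p i ∈ Set.Icc 0 (T.diagonal i) := by
  simp [carrier, Fin.forall_fin_two, diagonal]

/-- The columns of the staircase have modulus one, except for that of `V_0`, which is a square. -/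
theorem diagonal_add_diagonal_up (T : Tile n) :
    T.diagonal 1 + (T.next 1).diagonal 1 = T.diagonal 0 ∨
      T.next 1 = T ∧ T.diagonal 1 = T.diagonal 0 := by
  cases T with
  | V j hj =>
    by_cases hj' : 1 ≤ j
    · left
      obtain ⟨j, rfl⟩ := Nat.exists_eq_add_of_le' hj'
      have := v_add_v_succ (show 2 ≤ n by omega) j
      simp [next, up, diagonal, height, width]
      linarith
    · right
      obtain rfl : j = 0 := by omega
      simp [next, up, diagonal, height, width, h_zero (show 2 ≤ n by omega),
        v_zero (show 2 ≤ n by omega)]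
  | H i hi =>
    left
    obtain ⟨i, rfl⟩ := Nat.exists_eq_add_of_le' hi.1
    have := v_add_v_succ (show 2 ≤ n by omega) i
    by_cases hi' : i + 1 < n / 2
    · simp [next, up, diagonal, height, width, hi']
      linarith
    -- This rectangle is glued to itself only when n is odd and it is the last one; the symmetry of
    -- `v` then gives a missing neighbour the same height.
    · rw [v_symm (n := n) (i := i + 1) (j := i) (by omega)] at this
      simp [next, up, diagonal, height, width, hi']
      linarith

theorem diagonal_add_diagonal_right (T : Tile n) :
    T.diagonal 0 + (T.next 0).diagonal 0 = rowModulus n * T.diagonal 1 := by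
  cases T with
  | V j hj =>
    have := h_add_h_succ (show 2 ≤ n by omega) j
    by_cases hj' : j + 1 < (n + 1) / 2
    · simp [next, right, diagonal, height, width, hj']
      linarith
    · rw [h_symm (n := n) (i := j + 1) (j := j) (by omega)] at this
      simp [next, right, diagonal, height, width, hj']
      linarith
  | H i hi =>
    obtain ⟨i, rfl⟩ := Nat.exists_eq_add_of_le' hi.1
    have := h_add_h_succ (show 2 ≤ n by omega) i
    simp [next, right, diagonal, height, width]
    linarith

end Tile

/-! ### Points of the surface -/

section Surface

variable {n : ℕ}

theorem glue_iff {P Q : TilePoint n} : Glue n P Q ↔ ∃ k, Q.tile = P.tile.next k ∧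
    P.pos k = P.tile.diagonal k ∧ Q.pos k = 0 ∧ ∀ l, k ≠ l → Q.pos l = P.pos l := by
  simp [Glue, Fin.exists_fin_two, Fin.forall_fin_two, Tile.next, Tile.diagonal]

theorem isVertex_mk {T : Tile n} {p : Fin 2 → ℝ} {hp : p ∈ T.carrier} :
    IsVertex (Surface.mk T p hp) ↔ ∀ i, p i = 0 ∨ p i = T.diagonal i := by
  -- Being a corner is invariant under gluing, so it can be tested on any representative.
  let corner : Surface n → Prop := Quot.lift
    (fun P => ∀ i, P.pos i = 0 ∨ P.pos i = P.tile.diagonal i) (by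
      rintro ⟨S, p, hp⟩ ⟨S', q, hq⟩ hg
      obtain ⟨k, h1, h2, h3, h4⟩ := glue_iff.1 hg
      dsimp only at *
      subst h1
      refine propext (forall_congr' fun i => ?_)
      by_cases hk : k = i
      · subst hk
        simp [h2, h3]
      · rw [h4 i hk, Tile.diagonal_next hk])
  constructor
  · rintro ⟨S, q, hq, h0, h1, he⟩
    have : corner (Surface.mk S q hq) := Fin.forall_fin_two.2 ⟨h0, h1⟩
    rw [← he] at this
    exact this
  · intro h
    exact ⟨T, p, hp, h 0, h 1, rfl⟩

/-- The point of the surface with the given coordinates in `T`, which are projected to the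
rectangle if they lie outside. -/
noncomputable def place (T : Tile n) (p : Fin 2 → ℝ) : Surface n :=
  Surface.mk T (fun i => max 0 (min (p i) (T.diagonal i))) (Tile.mem_carrier_iff.2 fun i =>
    ⟨le_max_left _ _, max_le (T.diagonal_pos i).le (min_le_right _ _)⟩)

theorem Surface.mk_congr {T : Tile n} {p q : Fin 2 → ℝ} (hp : p ∈ T.carrier) (hq : q ∈ T.carrier)
    (h : p = q) : Surface.mk T p hp = Surface.mk T q hq := by
  subst h
  rfl

theorem place_of_mem {T : Tile n} {p : Fin 2 → ℝ} (hp : p ∈ T.carrier) :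
    place T p = Surface.mk T p hp := by
  refine Surface.mk_congr _ _ (funext fun i => ?_)
  have := Tile.mem_carrier_iff.1 hp i
  rw [min_eq_left this.2, max_eq_right this.1]

theorem place_glue {k : Fin 2} {T : Tile n} {p : Fin 2 → ℝ} (hp : p k = T.diagonal k) :
    place T p = place (T.next k) (Function.update p k 0) := by
  refine Quot.sound (glue_iff.2 ⟨k, rfl, ?_, ?_, fun l hl => ?_⟩)
  · simp [hp, (T.diagonal_pos k).le]
  · simp [((T.next k).diagonal_pos k).le]
  · simp [Function.update_of_ne hl.symm, Tile.diagonal_next hl]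

theorem not_isVertex_place {l : Fin 2} {T : Tile n} {p : Fin 2 → ℝ}
    (hp : p l ∈ Set.Ioo 0 (T.diagonal l)) : ¬ IsVertex (place T p) := by
  intro h
  have := isVertex_mk.1 h l
  rw [min_eq_left hp.2.le, max_eq_right hp.1.le] at this
  exact this.elim hp.1.ne' hp.2.ne

/-! ### Straight lines -/

theorem straight_mk {T : Tile n} {w p q : Fin 2 → ℝ} {t : ℝ} (ht : 0 < t) (hp : p ∈ T.carrier)
    (hq : q ∈ T.carrier) (h : q = p + t • w) :
    Straight w t (Surface.mk T p hp) (Surface.mk T q hq) := by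
  subst h
  exact Straight.segment T p t ht hp hq

theorem straight_place {T : Tile n} {w p q : Fin 2 → ℝ} {t : ℝ} (ht : 0 < t)
    (hp : ∀ i, p i ∈ Set.Icc 0 (T.diagonal i)) (hq : ∀ i, q i ∈ Set.Icc 0 (T.diagonal i))
    (h : ∀ i, q i = p i + t * w i) : Straight w t (place T p) (place T q) := by
  rw [place_of_mem (Tile.mem_carrier_iff.2 hp), place_of_mem (Tile.mem_carrier_iff.2 hq)]
  exact straight_mk ht _ _ (funext h)

theorem Straight.pos {w : Fin 2 → ℝ} {t : ℝ} {a b : Surface n} (hs : Straight w t a b) :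
    0 < t := by
  induction hs with
  | segment T p t ht hp hq => exact ht
  | trans s t a b c hab hb hbc ih1 ih2 => exact add_pos ih1 ih2

theorem Straight.reverse {w : Fin 2 → ℝ} {t : ℝ} {a b : Surface n} (hs : Straight w t a b) :
    Straight (-w) t b a := by
  induction hs with
  | segment T p t ht hp hq => exact straight_mk ht hq hp (by simp)
  | trans s t a b c hab hb hbc ih1 ih2 =>
    rw [add_comm]
    exact Straight.trans t s c b a ih2 hb ih1

theorem neg_mem_saddleConnections {w : Fin 2 → ℝ} (hw : w ∈ saddleConnections n) :
    -w ∈ saddleConnections n := by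
  obtain ⟨h0, a, b, ha, hb, hs⟩ := hw
  exact ⟨neg_ne_zero.2 h0, b, a, hb, ha, hs.reverse⟩

/-- The position of a point within its row (`k = 1`) or column (`k = 0`). -/
theorem exists_level (n : ℕ) (k : Fin 2) : ∃ f : Surface n → ℝ, ∀ T p hp,
    f (Surface.mk T p hp) = if p k = T.diagonal k then 0 else p k := by
  refine ⟨Quot.lift (fun P => if P.pos k = P.tile.diagonal k then 0 else P.pos k) ?_,
    fun T p hp => rfl⟩
  rintro ⟨S, p, hp⟩ ⟨S', q, hq⟩ hg
  obtain ⟨l, h1, h2, h3, h4⟩ := glue_iff.1 hg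
  dsimp only at *
  subst h1
  by_cases hk : l = k
  · subst hk
    simp [h2, h3]
  · simp only [h4 k hk, Tile.diagonal_next hk]

/-- A saddle connection not parallel to the rows (or columns) crosses one of them. -/
theorem one_le_abs_of_mem {w : Fin 2 → ℝ} (hw : w ∈ saddleConnections n) {k : Fin 2}
    (hk : w k ≠ 0) : 1 ≤ |w k| := by
  wlog hpos : 0 < w k generalizing w
  · simpa using this (neg_mem_saddleConnections hw) (by simpa using hk)
      (by simpa using lt_of_le_of_ne (not_lt.1 hpos) hk)
  obtain ⟨f, hf⟩ := exists_level n k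
  -- While the level stays below one it cannot reach the far edge of a rectangle, so it grows
  -- linearly. Vertices have level zero, so one cannot be reached this soon.
  have key (t : ℝ) (a b : Surface n) (hs : Straight w t a b) (h1 : f a + t * w k < 1) :
      f b = f a + t * w k := by
    induction hs with
    | segment T p t ht hp hq =>
      have hp' := (Tile.mem_carrier_iff.1 hp k)
      have hq' := (Tile.mem_carrier_iff.1 hq k).2
      have hd := T.one_le_diagonal k
      have hm := mul_pos ht hpos
      simp only [Pi.add_apply, Pi.smul_apply, smul_eq_mul] at hq'
      rw [hf, if_neg fun h => by linarith] at h1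
      rw [hf, hf, if_neg (c := p k = _) fun h => by linarith, if_neg]
      · rfl
      · rw [Pi.add_apply, Pi.smul_apply, smul_eq_mul]
        intro h
        linarith
    | trans s t a b c hab hb hbc ih1 ih2 =>
      have := mul_pos hbc.pos hpos
      rw [add_mul] at h1
      have e := ih1 (by linarith)
      rw [ih2 (by linarith), e]
      ring
  have vert (a : Surface n) (ha : IsVertex a) : f a = 0 := by
    obtain ⟨⟨T, p, hp⟩, rfl⟩ := Quot.exists_rep a
    have := isVertex_mk.1 ha k
    change f (Surface.mk T p hp) = 0
    rw [hf]
    split_ifs with h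
    · rfl
    · exact this.resolve_right h
  obtain ⟨h0, a, b, ha, hb, hs⟩ := hw
  by_contra! hlt
  rw [abs_of_pos hpos] at hlt
  have := key 1 a b hs (by rw [vert a ha]; linarith)
  rw [vert a ha, vert b hb] at this
  linarith

/-! ### Developed cylinders -/

/-- The circumference of the row (`k = 0`) or column (`k = 1`) of a rectangle (or twice the
circumference, for a rectangle glued to itself). -/
noncomputable def period (k : Fin 2) (T : Tile n) : ℝ := T.diagonal k + (T.next k).diagonal k

theorem period_pos (k : Fin 2) (T : Tile n) : 0 < period k T :=
  add_pos (T.diagonal_pos k) ((T.next k).diagonal_pos k)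

theorem period_next (k : Fin 2) (T : Tile n) : period k (T.next k) = period k T := by
  rw [period, Tile.next_next, period, add_comm]

/-- The row (`k = 0`) or column (`k = 1`) of the rectangle `T`, developed to an infinite strip: the
point whose coordinate along the strip is `s`, and whose other coordinate is that of `p`. -/
noncomputable def cylinder (k : Fin 2) (T : Tile n) (p : Fin 2 → ℝ) (s : ℝ) : Surface n :=
  if period k T * Int.fract (s / period k T) ≤ T.diagonal k then
    place T (Function.update p k (period k T * Int.fract (s / period k T)))
  else place (T.next k)
    (Function.update p k (period k T * Int.fract (s / period k T) - T.diagonal k))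

theorem cylinder_add_period (k : Fin 2) (T : Tile n) (p : Fin 2 → ℝ) (s : ℝ) (m : ℤ) :
    cylinder k T p (s + m * period k T) = cylinder k T p s := by
  have : (s + m * period k T) / period k T = s / period k T + m := by
    rw [add_div, mul_div_cancel_right₀ _ (period_pos k T).ne']
  simp only [cylinder, this, Int.fract_add_intCast]

theorem cylinder_congr {k : Fin 2} (T : Tile n) {p q : Fin 2 → ℝ} (s : ℝ)
    (h : ∀ l, k ≠ l → p l = q l) : cylinder k T p s = cylinder k T q s := by
  have (r : ℝ) : Function.update p k r = Function.update q k r := by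
    funext i
    by_cases hi : k = i
    · subst hi
      simp
    · simp [Function.update_of_ne (Ne.symm hi), h i hi]
  simp only [cylinder, this]

theorem period_mul_fract {k : Fin 2} {T : Tile n} {s : ℝ} (h0 : 0 ≤ s) (h1 : s < period k T) :
    period k T * Int.fract (s / period k T) = s := by
  have hP := period_pos k T
  rw [Int.fract_eq_self.2 ⟨by positivity, (div_lt_one hP).2 h1⟩, mul_div_cancel₀ _ hP.ne']

theorem cylinder_of_le {k : Fin 2} {T : Tile n} (p : Fin 2 → ℝ) {s : ℝ} (h0 : 0 ≤ s)
    (h1 : s ≤ T.diagonal k) : cylinder k T p s = place T (Function.update p k s) := by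
  have : s < period k T := lt_of_le_of_lt h1 (lt_add_of_pos_right _ ((T.next k).diagonal_pos k))
  rw [cylinder, period_mul_fract h0 this, if_pos h1]

theorem cylinder_of_lt {k : Fin 2} {T : Tile n} (p : Fin 2 → ℝ) {s : ℝ} (h0 : T.diagonal k < s)
    (h1 : s < period k T) :
    cylinder k T p s = place (T.next k) (Function.update p k (s - T.diagonal k)) := by
  rw [cylinder, period_mul_fract ((T.diagonal_pos k).le.trans h0.le) h1, if_neg h0.not_ge]

theorem exists_add_period (k : Fin 2) (T : Tile n) (s : ℝ) :
    ∃ (m : ℤ) (r : ℝ), 0 ≤ r ∧ r < period k T ∧ s = r + m * period k T := by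
  have hP := period_pos k T
  refine ⟨⌊s / period k T⌋, period k T * Int.fract (s / period k T),
    mul_nonneg hP.le (Int.fract_nonneg _), ?_, ?_⟩
  · nlinarith [Int.fract_lt_one (s / period k T)]
  · rw [mul_comm, ← add_mul, Int.fract_add_floor, div_mul_cancel₀ _ hP.ne']

/-- Developing from the neighbour only moves the origin of the strip. The cases are the positions
relative to the edge where the development changes rectangle. -/
theorem cylinder_next (k : Fin 2) (T : Tile n) (p : Fin 2 → ℝ) (s : ℝ) :
    cylinder k (T.next k) p s = cylinder k T p (s + T.diagonal k) := by
  obtain ⟨m, r, h0, h1, rfl⟩ := exists_add_period k T s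
  have e := cylinder_add_period k (T.next k) p r m
  rw [period_next] at e
  rw [e, add_right_comm, cylinder_add_period]
  have hL := T.diagonal_pos k
  have hL' := (T.next k).diagonal_pos k
  rcases lt_trichotomy r ((T.next k).diagonal k) with h | h | h
  · rw [cylinder_of_le p h0 h.le]
    rcases h0.eq_or_lt with rfl | h0
    · rw [zero_add, cylinder_of_le p hL.le le_rfl,
        place_glue (k := k) (T := T) (p := Function.update p k (T.diagonal k)) (by simp)]
      simp
    · rw [cylinder_of_lt p (by linarith) (by rw [period]; linarith)]
      simp
  · rw [cylinder_of_le p h0 h.le, place_glue (k := k) (by simpa using h), Tile.next_next]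
    have := cylinder_add_period k T p 0 1
    rw [Int.cast_one, one_mul, zero_add] at this
    rw [h, add_comm, ← period, this, cylinder_of_le p le_rfl hL.le]
    simp
  · rw [cylinder_of_lt p h (by rwa [period_next]), Tile.next_next]
    have := cylinder_add_period k T p (r - (T.next k).diagonal k) 1
    rw [Int.cast_one, one_mul, period, sub_add_add_cancel] at this
    rw [period] at h1
    rw [this, cylinder_of_le p (by linarith) (by linarith)]

theorem not_isVertex_cylinder {k l : Fin 2} (hkl : k ≠ l) {T : Tile n} {p : Fin 2 → ℝ}
    (hp : p l ∈ Set.Ioo 0 (T.diagonal l)) (s : ℝ) : ¬ IsVertex (cylinder k T p s) := by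
  unfold cylinder
  split_ifs
  · exact not_isVertex_place (l := l) (by rwa [Function.update_of_ne hkl.symm])
  · exact not_isVertex_place (l := l)
      (by rwa [Function.update_of_ne hkl.symm, Tile.diagonal_next hkl])

theorem exists_cylinder_recenter (k : Fin 2) (T : Tile n) (s : ℝ) :
    ∃ (S : Tile n) (d : ℝ), (∀ l, k ≠ l → S.diagonal l = T.diagonal l) ∧
      0 ≤ s - d ∧ s - d < S.diagonal k ∧ ∀ p r, cylinder k T p r = cylinder k S p (r - d) := by
  obtain ⟨m, r, h0, h1, rfl⟩ := exists_add_period k T s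
  by_cases h : r < T.diagonal k
  · refine ⟨T, m * period k T, fun _ _ => rfl, by simpa using h0, by simpa using h, fun p x => ?_⟩
    rw [← cylinder_add_period k T p (x - m * period k T) m, sub_add_cancel]
  · refine ⟨T.next k, m * period k T + T.diagonal k, fun l hl => Tile.diagonal_next hl T,
      by linarith, ?_, fun p x => ?_⟩
    · unfold period at *
      linarith
    · rw [cylinder_next, ← cylinder_add_period k T p (_ + _) m]
      congr 1
      ring

end Surface

end Staircase

namespace Staircase

variable {n : ℕ}

/-! ### Shears -/

/-- The segment from `p` to `p + t w` lies in the strip of `T`, and in its interior except possibly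
for the end points. -/
def InStrip (l : Fin 2) (T : Tile n) (w p : Fin 2 → ℝ) (t : ℝ) : Prop :=
  (∀ τ ∈ Set.Icc 0 t, p l + τ * w l ∈ Set.Icc 0 (T.diagonal l)) ∧
    ∀ τ ∈ Set.Ioo 0 t, p l + τ * w l ∈ Set.Ioo 0 (T.diagonal l)

theorem InStrip.sub {l : Fin 2} {T : Tile n} {w p : Fin 2 → ℝ} {t a b : ℝ}
    (hI : InStrip l T w p t) (ha : 0 ≤ a) (hab : a + b ≤ t) :
    InStrip l T w (p + a • w) b := by
  constructor <;> intro τ hτ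
  · have := hI.1 (a + τ) ⟨by linarith [hτ.1], by linarith [hτ.2]⟩
    rw [add_mul, ← add_assoc] at this
    exact this
  · have := hI.2 (a + τ) ⟨by linarith [hτ.1], by linarith [hτ.2]⟩
    rw [add_mul, ← add_assoc] at this
    exact this

theorem InStrip.left {l : Fin 2} {T : Tile n} {w p : Fin 2 → ℝ} {t b : ℝ}
    (hI : InStrip l T w p t) (hb : b ≤ t) : InStrip l T w p b := by
  simpa using hI.sub (a := 0) le_rfl (by simpa using hb)

theorem InStrip.reverse {l : Fin 2} {T : Tile n} {w p : Fin 2 → ℝ} {t : ℝ}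
    (hI : InStrip l T w p t) : InStrip l T (-w) (p + t • w) t := by
  constructor <;> intro τ hτ
  · have := hI.1 (t - τ) ⟨by linarith [hτ.2], by linarith [hτ.1]⟩
    rw [sub_mul] at this
    convert this using 1
    simp
    ring
  · have := hI.2 (t - τ) ⟨by linarith [hτ.2], by linarith [hτ.1]⟩
    rw [sub_mul] at this
    convert this using 1
    simp
    ring

theorem straight_cylinder_of_le {k l : Fin 2} (hkl : k ≠ l) {T : Tile n} {w p : Fin 2 → ℝ}
    {s t : ℝ} (ht : 0 < t) (hI : InStrip l T w p t) (h0 : 0 ≤ s) (h1 : s ≤ T.diagonal k)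
    (h2 : 0 ≤ s + t * w k) (h3 : s + t * w k ≤ T.diagonal k) :
    Straight w t (cylinder k T p s) (cylinder k T (p + t • w) (s + t * w k)) := by
  rw [cylinder_of_le _ h0 h1, cylinder_of_le _ h2 h3]
  have hi (i : Fin 2) : i = k ∨ i = l := by omega
  refine straight_place ht (fun i => ?_) (fun i => ?_) fun i => ?_ <;>
    rcases hi i with rfl | rfl
  · simpa using ⟨h0, h1⟩
  · simpa [Function.update_of_ne hkl.symm] using hI.1 0 ⟨le_rfl, ht.le⟩
  · simpa using ⟨h2, h3⟩
  · simpa [Function.update_of_ne hkl.symm] using hI.1 t ⟨ht.le, le_rfl⟩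
  · simp
  · simp [Function.update_of_ne hkl.symm]

theorem straight_cylinder_split {k l : Fin 2} (hkl : k ≠ l) {T : Tile n} {w p : Fin 2 → ℝ}
    {s t t₀ : ℝ} (h0 : 0 < t₀) (h1 : t₀ < t) (hI : InStrip l T w p t)
    (ha : Straight w t₀ (cylinder k T p s) (cylinder k T (p + t₀ • w) (s + t₀ * w k)))
    (hb : Straight w (t - t₀) (cylinder k T (p + t₀ • w) (s + t₀ * w k))
      (cylinder k T (p + t₀ • w + (t - t₀) • w) (s + t₀ * w k + (t - t₀) * w k))) :
    Straight w t (cylinder k T p s) (cylinder k T (p + t • w) (s + t * w k)) := by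
  have := Straight.trans t₀ (t - t₀) _ _ _ ha
    (not_isVertex_cylinder hkl (hI.2 t₀ ⟨h0, h1⟩) _) hb
  rw [add_assoc p, ← add_smul, add_assoc s, ← add_mul, add_sub_cancel] at this
  exact this

/-- Sides have length at least one, so a displacement of at most one along the strip needs at most
one cut, at the time `t₀` of reaching an edge. -/
theorem straight_cylinder_short {k l : Fin 2} (hkl : k ≠ l) {T : Tile n} {w p : Fin 2 → ℝ}
    {s t : ℝ} (ht : 0 < t) (hI : InStrip l T w p t) (h1 : |t * w k| ≤ 1) :
    Straight w t (cylinder k T p s) (cylinder k T (p + t • w) (s + t * w k)) := by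
  wlog hw : 0 ≤ w k generalizing p s w
  · have := (this hI.reverse (s := s + t * w k) (by simpa using h1)
      (by simpa using (not_le.1 hw).le)).reverse
    simpa using this
  rw [abs_of_nonneg (by positivity)] at h1
  obtain ⟨S, d, hS, h2, h3, e⟩ := exists_cylinder_recenter k T s
  rw [e, e, show s + t * w k - d = s - d + t * w k by ring]
  generalize s - d = r at *
  have hI : InStrip l S w p t := by rwa [InStrip, hS l hkl]
  have hm : 0 ≤ t * w k := by positivity
  by_cases h4 : r + t * w k ≤ S.diagonal k
  · exact straight_cylinder_of_le hkl ht hI h2 h3.le (by linarith) h4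
  push Not at h4
  have hw' : 0 < w k := lt_of_le_of_ne hw fun h => by rw [← h] at h4; linarith
  have ht₀ : (S.diagonal k - r) / w k * w k = S.diagonal k - r := div_mul_cancel₀ _ hw'.ne'
  have hpos : 0 < (S.diagonal k - r) / w k := div_pos (by linarith) hw'
  have hlt : (S.diagonal k - r) / w k < t := (div_lt_iff₀ hw').2 (by linarith)
  generalize (S.diagonal k - r) / w k = t₀ at *
  refine straight_cylinder_split hkl hpos hlt hI
    (straight_cylinder_of_le hkl hpos (hI.left hlt.le) h2 h3.le (by linarith) (by linarith)) ?_
  have hI' : InStrip l (S.next k) w (p + t₀ • w) (t - t₀) := by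
    have := hI.sub hpos.le (b := t - t₀) (by linarith)
    rwa [InStrip, Tile.diagonal_next hkl]
  have hn := (S.next k).one_le_diagonal k
  have h5 := straight_cylinder_of_le hkl (s := 0) (sub_pos.2 hlt) hI' le_rfl (by linarith)
    (by nlinarith) (by nlinarith)
  rw [cylinder_next, cylinder_next] at h5
  convert h5 using 2 <;> linarith

theorem straight_cylinder {k l : Fin 2} (hkl : k ≠ l) {T : Tile n} {w p : Fin 2 → ℝ}
    {s t : ℝ} (ht : 0 < t) (hI : InStrip l T w p t) :
    Straight w t (cylinder k T p s) (cylinder k T (p + t • w) (s + t * w k)) := by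
  obtain ⟨N, hN⟩ := exists_nat_ge |t * w k|
  induction N generalizing p s t with
  | zero => exact straight_cylinder_short hkl ht hI (hN.trans (by simp))
  | succ N ih =>
    rcases N.eq_zero_or_pos with rfl | hNpos
    · exact straight_cylinder_short hkl ht hI (hN.trans (by simp))
    have hN0 : (0 : ℝ) < N := by exact_mod_cast hNpos
    rw [abs_mul, abs_of_pos ht] at hN
    push_cast at hN
    have h0 : 0 < t / (N + 1) := by positivity
    have h1 : t / (N + 1) < t := div_lt_self ht (by linarith)
    have e : t / (N + 1) * (N + 1) = t := div_mul_cancel₀ _ (by positivity)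
    have hle : t / (N + 1) * |w k| ≤ 1 := by
      rw [div_mul_eq_mul_div, div_le_one (by positivity)]
      exact hN
    generalize t / (N + 1) = t₀ at *
    refine straight_cylinder_split hkl h0 h1 hI
      (straight_cylinder_short hkl h0 (hI.left h1.le) ?_)
      (ih (sub_pos.2 h1) (hI.sub h0.le (by linarith)) ?_)
    · rwa [abs_mul, abs_of_pos h0]
    · rw [abs_mul, abs_of_pos (sub_pos.2 h1), show t - t₀ = t₀ * N by linarith]
      nlinarith

/-- Across edges inside a strip the formula is consistent by `cylinder_next`; on the boundary of a
strip the shift is a full number of turns, so points there stay fixed. -/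
theorem exists_shear {k l : Fin 2} (hkl : k ≠ l) (c : ℝ)
    (hper : ∀ (T : Tile n) p s, cylinder k T p (s + c * T.diagonal l) = cylinder k T p s) :
    ∃ φ : Surface n → Surface n, ∀ T p hp,
      φ (Surface.mk T p hp) = cylinder k T p (p k + c * p l) := by
  refine ⟨Quot.lift (fun P => cylinder k P.tile P.pos (P.pos k + c * P.pos l)) ?_,
    fun T p hp => rfl⟩
  rintro ⟨S, p, hp⟩ ⟨S', q, hq⟩ hg
  have hpq : Surface.mk S p hp = Surface.mk S' q hq := Quot.sound hg
  obtain ⟨i, h1, h2, h3, h4⟩ := glue_iff.1 hg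
  have hi : i = k ∨ i = l := by omega
  dsimp only at *
  subst h1
  rcases hi with rfl | rfl
  · rw [cylinder_next, h3, h4 l hkl, cylinder_congr S _ h4, h2]
    congr 1
    ring
  · have hS := Tile.mem_carrier_iff.1 hp k
    have hS' := Tile.mem_carrier_iff.1 hq k
    rw [h2, h3, hper, mul_zero, add_zero, cylinder_of_le p hS.1 hS.2,
      cylinder_of_le q hS'.1 hS'.2, Function.update_eq_self, Function.update_eq_self,
      place_of_mem hp, place_of_mem hq, hpq]

/-- Shears in the direction of the rows (`k = 0`) or columns (`k = 1`) by a common multiple of their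
moduli preserve the set of saddle connections. -/
theorem shear_mem_saddleConnections {k l : Fin 2} (hkl : k ≠ l) (c : ℝ)
    (hper : ∀ (T : Tile n) p s, cylinder k T p (s + c * T.diagonal l) = cylinder k T p s)
    {w : Fin 2 → ℝ} (hw : w ∈ saddleConnections n) :
    Function.update w k (w k + c * w l) ∈ saddleConnections n := by
  obtain ⟨φ, hφ⟩ := exists_shear hkl c hper
  have hbd {T p} (hp : p ∈ Tile.carrier T) (h : p l = 0 ∨ p l = T.diagonal l) :
      φ (Surface.mk T p hp) = Surface.mk T p hp := by
    have hk := Tile.mem_carrier_iff.1 hp k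
    have : cylinder k T p (p k + c * p l) = cylinder k T p (p k) := by
      rcases h with h | h
      · rw [h, mul_zero, add_zero]
      · rw [h, hper]
    rw [hφ, this, cylinder_of_le p hk.1 hk.2, Function.update_eq_self, place_of_mem hp]
  have hvert {a : Surface n} (ha : IsVertex a) : φ a = a := by
    obtain ⟨⟨T, p, hp⟩, rfl⟩ := Quot.exists_rep a
    exact hbd hp (isVertex_mk.1 ha l)
  have hnvert {a : Surface n} (ha : ¬ IsVertex a) : ¬ IsVertex (φ a) := by
    obtain ⟨⟨T, p, hp⟩, rfl⟩ := Quot.exists_rep a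
    change ¬ IsVertex (φ (Surface.mk T p hp))
    by_cases h : p l = 0 ∨ p l = T.diagonal l
    · rw [hbd hp h]
      exact ha
    · push Not at h
      have hl := Tile.mem_carrier_iff.1 hp l
      rw [hφ]
      exact not_isVertex_cylinder hkl ⟨lt_of_le_of_ne hl.1 h.1.symm, lt_of_le_of_ne hl.2 h.2⟩ _
  have hstr {t : ℝ} {a b : Surface n} (hs : Straight w t a b) :
      Straight (Function.update w k (w k + c * w l)) t (φ a) (φ b) := by
    induction hs with
    | segment T p t ht hp hq =>
      have hp' := Tile.mem_carrier_iff.1 hp l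
      have hq' := Tile.mem_carrier_iff.1 hq l
      simp only [Pi.add_apply, Pi.smul_apply, smul_eq_mul] at hq'
      -- A segment running along the boundary of the strip is not in `InStrip`, but is fixed
      -- pointwise.
      by_cases h : w l = 0 ∧ (p l = 0 ∨ p l = T.diagonal l)
      · rw [hbd hp h.2, hbd hq (by simpa [h.1] using h.2), h.1, mul_zero, add_zero,
          Function.update_eq_self]
        exact Straight.segment T p t ht hp hq
      · have hI : InStrip l T (Function.update w k (w k + c * w l)) p t := by
          rw [InStrip, Function.update_of_ne hkl.symm]
          constructor <;> intro τ hτ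
          · have h1 := hτ.1
            have h2 := hτ.2
            rcases le_total 0 (w l) with h0 | h0
            · exact ⟨by nlinarith [hp'.1], by nlinarith [hq'.2]⟩
            · exact ⟨by nlinarith [hq'.1], by nlinarith [hp'.2]⟩
          · have h1 := hτ.1
            have h2 := hτ.2
            rcases lt_trichotomy 0 (w l) with h0 | h0 | h0
            · exact ⟨by nlinarith [hp'.1], by nlinarith [hq'.2]⟩
            · rw [← h0, mul_zero, add_zero]
              simp only [← h0, true_and] at h
              push Not at h
              exact ⟨lt_of_le_of_ne hp'.1 h.1.symm, lt_of_le_of_ne hp'.2 h.2⟩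
            · exact ⟨by nlinarith [hq'.1], by nlinarith [hp'.2]⟩
        have := straight_cylinder (s := p k + c * p l) hkl ht hI
        rw [hφ, hφ]
        convert this using 1
        rw [cylinder_congr (q := p + t • Function.update w k (w k + c * w l)) T _
          fun i hi => by simp [Function.update_of_ne hi.symm]]
        congr 1
        simp
        ring
    | trans s t a b c hab hb hbc ih1 ih2 => exact Straight.trans s t _ _ _ ih1 (hnvert hb) ih2
  obtain ⟨h0, a, b, ha, hb, hs⟩ := hw
  refine ⟨fun h => h0 ?_, φ a, φ b, ?_, ?_, hstr hs⟩
  · have hl : w l = 0 := by simpa [Function.update_of_ne hkl.symm] using congrFun h l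
    have hk : w k = 0 := by simpa [hl] using congrFun h k
    funext i
    rcases (show i = k ∨ i = l by omega) with rfl | rfl <;> assumption
  · rwa [hvert ha]
  · rwa [hvert hb]

theorem shear_right_mem {a b : ℝ} (hw : ![a, b] ∈ saddleConnections n) :
    ![a + rowModulus n * b, b] ∈ saddleConnections n := by
  have := shear_mem_saddleConnections (k := 0) (l := 1) (by decide) (rowModulus n)
    (fun T p s => by
      rw [← Tile.diagonal_add_diagonal_right]
      simpa [period] using cylinder_add_period 0 T p s 1) hw
  convert this using 1
  funext i
  fin_cases i <;> simp

theorem shear_down_mem {a b : ℝ} (hw : ![a, b] ∈ saddleConnections n) :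
    ![a, b - a] ∈ saddleConnections n := by
  have key (T : Tile n) (p : Fin 2 → ℝ) (s : ℝ) :
      cylinder 1 T p (s + T.diagonal 0) = cylinder 1 T p s := by
    -- For `V_0` the number `period` is twice the circumference, so the shift by its side comes from
    -- its being its own neighbour.
    rcases T.diagonal_add_diagonal_up with h | ⟨h, h'⟩
    · rw [← h]
      simpa [period] using cylinder_add_period 1 T p s 1
    · rw [← h', ← cylinder_next, h]
  have := shear_mem_saddleConnections (k := 1) (l := 0) (by decide) (-1)
    (fun T p s => by rw [← key T p (s + -1 * T.diagonal 0)]; congr 1; ring) hw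
  convert this using 1
  funext i
  fin_cases i <;> simp [sub_eq_add_neg]

end Staircase

namespace Staircase

variable {n : ℕ}

/-! ### Saddle connections and the diagonals -/

theorem diagonal_mem_saddleConnections (T : Tile n) : T.diagonal ∈ saddleConnections n := by
  have h0 : (0 : Fin 2 → ℝ) ∈ T.carrier := Tile.mem_carrier_iff.2 fun i =>
    ⟨le_rfl, (T.diagonal_pos i).le⟩
  have h1 : T.diagonal ∈ T.carrier := Tile.mem_carrier_iff.2 fun i =>
    ⟨(T.diagonal_pos i).le, le_rfl⟩
  exact ⟨fun h => (T.diagonal_pos 0).ne' (congrFun h 0), Surface.mk T _ h0, Surface.mk T _ h1,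
    isVertex_mk.2 fun i => Or.inl rfl, isVertex_mk.2 fun i => Or.inr rfl,
    straight_mk one_pos h0 h1 (by simp)⟩

theorem side_mem_saddleConnections (T : Tile n) (k : Fin 2) :
    Function.update (0 : Fin 2 → ℝ) k (T.diagonal k) ∈ saddleConnections n := by
  have h0 : (0 : Fin 2 → ℝ) ∈ T.carrier := Tile.mem_carrier_iff.2 fun i =>
    ⟨le_rfl, (T.diagonal_pos i).le⟩
  have h2 (i : Fin 2) : Function.update (0 : Fin 2 → ℝ) k (T.diagonal k) i = 0 ∨
      Function.update (0 : Fin 2 → ℝ) k (T.diagonal k) i = T.diagonal i := by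
    by_cases hi : i = k
    · subst hi
      simp
    · simp [Function.update_of_ne hi]
  have h1 : Function.update (0 : Fin 2 → ℝ) k (T.diagonal k) ∈ T.carrier := Tile.mem_carrier_iff.2 fun i => by
    rcases h2 i with h | h <;> rw [h] <;> simp [(T.diagonal_pos i).le]
  exact ⟨fun h => (T.diagonal_pos k).ne' (by simpa using congrFun h k), Surface.mk T _ h0,
    Surface.mk T _ h1, isVertex_mk.2 fun i => Or.inl rfl, isVertex_mk.2 h2,
    straight_mk one_pos h0 h1 (by simp)⟩

theorem horizontal_mem (hn : 2 ≤ n) : ![1, 0] ∈ saddleConnections n := by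
  convert side_mem_saddleConnections (Tile.V 0 (by omega) : Tile n) 0 using 1
  funext i
  fin_cases i <;> simp [Tile.diagonal, Tile.width, h_zero hn]

theorem vertical_mem (hn : 2 ≤ n) : ![0, 1] ∈ saddleConnections n := by
  convert side_mem_saddleConnections (Tile.V 0 (by omega) : Tile n) 1 using 1
  funext i
  fin_cases i <;> simp [Tile.diagonal, Tile.height, v_zero hn]

theorem hv_symm {i j : ℕ} (hj : 1 ≤ j) (hij : i + j + 1 = n) :
    (![h n i, v n i] : Fin 2 → ℝ) = ![h n j, v n (j - 1)] := by
  rw [h_symm hij, v_symm (j := j - 1) (by omega)]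

theorem hv_mem {i : ℕ} (hi : i + 2 ≤ n) : ![h n i, v n i] ∈ saddleConnections n := by
  by_cases h : i < n / 2
  · exact diagonal_mem_saddleConnections (Tile.V i h)
  · obtain ⟨j, rfl⟩ := Nat.exists_eq_add_of_le hi
    rw [hv_symm (j := j + 1) (by omega) (by omega)]
    exact diagonal_mem_saddleConnections (Tile.H (j + 1) ⟨by omega, by omega⟩)

/-- The parallelogram spanned by a saddle connection and one of the diagonals is degenerate or has
area at least one. -/
theorem one_le_abs_cross (hn : 2 ≤ n) (i : ℕ) {a b : ℝ} (hw : ![a, b] ∈ saddleConnections n)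
    (h0 : a * v n i - b * h n i ≠ 0) : 1 ≤ |a * v n i - b * h n i| := by
  induction i generalizing a b with
  | zero =>
    -- The cross product with (1, 1) is, up to sign, the height of the vector after the column
    -- shear.
    have := one_le_abs_of_mem (shear_down_mem hw) (k := 1)
    rw [h_zero hn, v_zero hn, mul_one, mul_one] at *
    rw [abs_sub_comm]
    exact this (by simpa [sub_ne_zero] using (sub_ne_zero.1 h0).symm)
  | succ i ih =>
    have h1 := v_add_v_succ hn i
    have h2 := h_add_h_succ hn i
    -- The column shear followed by the row shear has determinant one and sends d_{i+1} to -d_i.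
    have e : a * v n (i + 1) - b * h n (i + 1) =
        -((a + rowModulus n * (b - a)) * v n i - (b - a) * h n i) := by
      rw [show v n (i + 1) = h n (i + 1) - v n i by linarith,
        show h n (i + 1) = rowModulus n * v n i - h n i by linarith]
      ring
    rw [e] at h0 ⊢
    rw [abs_neg]
    exact ih (shear_right_mem (shear_down_mem hw)) (neg_ne_zero.1 h0)

/-- A saddle connection clockwise of the `i`-th diagonal is mapped outside of `(0, 1]` by a linear
functional which exceeds one on the later diagonals. -/
theorem one_lt_of_clockwise (hn : 2 ≤ n) {x y a b : ℝ} {i : ℕ} (hi : i + 2 ≤ n)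
    (hx : 0 < x) (hi0 : 0 < x * h n i + y * v n i)
    (hgt : ∀ j, i < j → j + 2 ≤ n → 1 < x * h n j + y * v n j)
    (hlast : 1 < x * h n (n - 2) + y * v n (n - 2) + x)
    (hw : ![a, b] ∈ saddleConnections n) (hb : 0 < b) (hcw : 0 < a * v n i - b * h n i) :
    1 < x * a + y * b := by
  obtain ⟨m, rfl⟩ := Nat.exists_eq_add_of_le hi
  have hend : a * v (i + 2 + m) (i + 2 + m - 1) - b * h (i + 2 + m) (i + 2 + m - 1) ≤ 0 := by
    rw [v_last (by omega), h_symm (j := 0) (by omega), h_zero hn]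
    linarith
  have hex : ∃ k, a * v (i + 2 + m) (i + k + 1) - b * h (i + 2 + m) (i + k + 1) ≤ 0 :=
    ⟨m, by rwa [show i + 2 + m - 1 = i + m + 1 by omega] at hend⟩
  -- The cone between consecutive diagonals that contains (a, b); the last one is bounded by d_{n-1}
  -- = (1, 0).
  obtain ⟨k, hk, hkm, hprev⟩ : ∃ k,
      a * v (i + 2 + m) (i + k + 1) - b * h (i + 2 + m) (i + k + 1) ≤ 0 ∧ k ≤ m ∧
      0 < a * v (i + 2 + m) (i + k) - b * h (i + 2 + m) (i + k) := by
    classical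
    refine ⟨Nat.find hex, Nat.find_spec hex, Nat.find_min' hex ?_, ?_⟩
    · rwa [show i + 2 + m - 1 = i + m + 1 by omega] at hend
    · rcases hz : Nat.find hex with _ | k'
      · exact hcw
      · exact not_le.1 (Nat.find_min hex (m := k') (by omega))
  have hbeta := one_le_abs_cross hn (i + k) hw hprev.ne'
  rw [abs_of_pos hprev] at hbeta
  have hcross := cross_diagonals hn (i + k)
  -- Coordinates in the unimodular basis d_{i+k}, d_{i+k+1}: the first coefficient is nonnegative,
  -- the second at least one.
  have e : x * a + y * b =
      -(a * v (i + 2 + m) (i + k + 1) - b * h (i + 2 + m) (i + k + 1)) *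
        (x * h (i + 2 + m) (i + k) + y * v (i + 2 + m) (i + k)) +
      (a * v (i + 2 + m) (i + k) - b * h (i + 2 + m) (i + k)) *
        (x * h (i + 2 + m) (i + k + 1) + y * v (i + 2 + m) (i + k + 1)) := by
    linear_combination (-(x * a) - y * b) * hcross
  have hk0 : 0 < x * h (i + 2 + m) (i + k) + y * v (i + 2 + m) (i + k) := by
    rcases Nat.eq_zero_or_pos k with rfl | hkpos
    · exact hi0
    · linarith [hgt (i + k) (by omega) (by omega)]
  rw [e]
  rcases hkm.lt_or_eq with hlt | rfl
  · have := hgt (i + k + 1) (by omega) (by omega)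
    nlinarith
  -- In the last cone ℓ(1, 0) = x need not exceed one. But here b > 0 forces the first coefficient
  -- to be at least one too, and `hlast` applies.
  · have hu : x * h (i + 2 + k) (i + k + 1) + y * v (i + 2 + k) (i + k + 1) = x := by
      have h1 := v_last (n := i + 2 + k) (by omega)
      rw [show i + 2 + k - 1 = i + k + 1 by omega] at h1
      rw [h1, h_symm (j := 0) (by omega), h_zero hn]
      ring
    have hne : a * v (i + 2 + k) (i + k + 1) - b * h (i + 2 + k) (i + k + 1) < 0 := by
      have h1 := v_last (n := i + 2 + k) (by omega)
      rw [show i + 2 + k - 1 = i + k + 1 by omega] at h1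
      rw [h1, h_symm (i := i + k + 1) (j := 0) (by omega), h_zero hn]
      linarith
    have halpha := one_le_abs_cross hn (i + k + 1) hw hne.ne
    rw [abs_of_neg hne] at halpha
    rw [show i + 2 + k - 2 = i + k by omega] at hlast
    rw [hu]
    nlinarith

/-! ### Winners and return times -/

theorem act_mem_saddleConnections {A : SpecialLinearGroup (Fin 2) ℝ} (hA : A ∈ veechGroup n)
    {w : Fin 2 → ℝ} (hw : w ∈ saddleConnections n) : act A w ∈ saddleConnections n := by
  obtain ⟨φ, hv, hs⟩ := hA
  obtain ⟨h0, a, b, ha, hb, hab⟩ := hw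
  refine ⟨fun h => h0 ?_, φ a, φ b, (hv a).2 ha, (hv b).2 hb, (hs w 1 a b).2 hab⟩
  rw [← act_one w, ← inv_mul_cancel A, act_mul, h]
  simp [act]

/-- The Veech group preserves saddle connections, so any representative of the coset may be tested.
-/
theorem coe_mem_poincareSection {g : SpecialLinearGroup (Fin 2) ℝ} :
    (g : SpecialLinearGroup (Fin 2) ℝ ⧸ veechGroup n) ∈ poincareSection n ↔
      ∃ w ∈ saddleConnections n, act g w 0 ∈ Set.Ioc (0 : ℝ) 1 ∧ act g w 1 = 0 := by
  constructor
  · rintro ⟨g', hg, w, hw, h⟩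
    refine ⟨act (g⁻¹ * g') w, act_mem_saddleConnections (QuotientGroup.eq.1 hg) hw, ?_⟩
    rwa [← act_mul, mul_inv_cancel_left]
  · exact fun h => ⟨g, rfl, h⟩

theorem act_horocycle_zero (s : ℝ) (w : Fin 2 → ℝ) : act (horocycle s) w 0 = w 0 := by
  simp [act, horocycle, mulVec, dotProduct, Fin.sum_univ_two]

theorem act_horocycle_one (s : ℝ) (w : Fin 2 → ℝ) : act (horocycle s) w 1 = w 1 - s * w 0 := by
  simp [act, horocycle, mulVec, dotProduct, Fin.sum_univ_two]
  ring

theorem act_M_zero {x y : ℝ} (hx : 0 < x) (w : Fin 2 → ℝ) :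
    act (M x y hx) w 0 = x * w 0 + y * w 1 := by
  simp [act, M, mulVec, dotProduct, Fin.sum_univ_two]

theorem act_M_one {x y : ℝ} (hx : 0 < x) (w : Fin 2 → ℝ) :
    act (M x y hx) w 1 = x⁻¹ * w 1 := by
  simp [act, M, mulVec, dotProduct, Fin.sum_univ_two]

/-- The return time is the slope of a winner. -/
theorem IsWinner.isReturnTime {g : SpecialLinearGroup (Fin 2) ℝ} {w : Fin 2 → ℝ}
    (hw : IsWinner n g w)
    (hg : (g : SpecialLinearGroup (Fin 2) ℝ ⧸ veechGroup n) ∈ poincareSection n) :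
    IsReturnTime n g (slope (act g w)) := by
  obtain ⟨hmem, ⟨h0, h1⟩, hmin⟩ := hw
  refine ⟨hg, ⟨h1, ?_⟩, ?_⟩
  · change ((horocycle _ * g : SpecialLinearGroup (Fin 2) ℝ) :
      SpecialLinearGroup (Fin 2) ℝ ⧸ veechGroup n) ∈ _
    rw [coe_mem_poincareSection]
    refine ⟨w, hmem, ?_, ?_⟩
    · rwa [act_mul, act_horocycle_zero]
    · rw [act_mul, act_horocycle_one, slope, div_mul_cancel₀ _ h0.1.ne', sub_self]
  · rintro s ⟨hs, hX⟩
    change ((horocycle s * g : SpecialLinearGroup (Fin 2) ℝ) :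
      SpecialLinearGroup (Fin 2) ℝ ⧸ veechGroup n) ∈ _ at hX
    obtain ⟨w', hw', h2, h3⟩ := coe_mem_poincareSection.1 hX
    rw [act_mul, act_horocycle_zero] at h2
    rw [act_mul, act_horocycle_one] at h3
    have e : slope (act g w') = s := by
      rw [slope, div_eq_iff h2.1.ne']
      linarith
    rw [← e]
    exact hmin w' hw' ⟨h2, by rwa [e]⟩

theorem isWinner_and_isReturnTime (hn : 2 ≤ n) {x y p q : ℝ} (hx : 0 < x) (hx1 : x ≤ 1)
    (hmem : ![p, q] ∈ saddleConnections n) (hq : 0 < q) (h0 : 0 < x * p + y * q)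
    (h1 : x * p + y * q ≤ 1)
    (hcw : ∀ a b, ![a, b] ∈ saddleConnections n → 0 < b → 0 < a * q - b * p →
      1 < x * a + y * b) :
    IsWinner n (M x y hx) ![p, q] ∧ IsReturnTime n (M x y hx) (q / (x * (p * x + q * y))) := by
  have hs (w : Fin 2 → ℝ) : slope (act (M x y hx) w) = w 1 / (x * (x * w 0 + y * w 1)) := by
    rw [slope, act_M_zero, act_M_one, ← div_div, div_eq_inv_mul (w 1)]
  have hwin : IsWinner n (M x y hx) ![p, q] := by
    refine ⟨hmem, ⟨?_, ?_⟩, fun w' hw' hc => ?_⟩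
    · rw [act_M_zero]
      exact ⟨h0, h1⟩
    · rw [hs]
      exact div_pos hq (mul_pos hx h0)
    · obtain ⟨a, b, rfl⟩ : ∃ a b, w' = ![a, b] := ⟨w' 0, w' 1, by
        funext i
        fin_cases i <;> rfl⟩
      obtain ⟨h2, h3⟩ := hc
      rw [act_M_zero] at h2
      rw [hs] at h3 ⊢
      rw [hs]
      change 0 < x * a + y * b ∧ x * a + y * b ≤ 1 at h2
      change 0 < b / (x * (x * a + y * b)) at h3
      change q / (x * (x * p + y * q)) ≤ b / (x * (x * a + y * b))
      have hb : 0 < b := (div_pos_iff_of_pos_right (mul_pos hx h2.1)).1 h3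
      have : a * q - b * p ≤ 0 := not_lt.1 fun h => (hcw a b hw' hb h).not_ge h2.2
      rw [div_le_div_iff₀ (mul_pos hx h0) (mul_pos hx h2.1)]
      nlinarith [mul_pos hx hx]
  refine ⟨hwin, ?_⟩
  have := hwin.isReturnTime (coe_mem_poincareSection.2 ⟨![1, 0], horizontal_mem hn, by
    rw [act_M_zero]
    simpa using ⟨hx, hx1⟩, by
    rw [act_M_one]
    simp⟩)
  rw [hs] at this
  rw [mul_comm p, mul_comm q]
  exact this

/-! ### The regions -/

theorem h_last (hn : 3 ≤ n) : h n (n - 2) = h n 1 := h_symm (by omega)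

theorem v_penultimate (hn : 3 ≤ n) : v n (n - 2) = 1 := by
  rw [v_symm (j := 0) (by omega), v_zero (by omega)]

theorem rowModulus_eq (hn : 3 ≤ n) : rowModulus n = 1 + h n 1 := by
  have := h_add_h_succ (show 2 ≤ n by omega) 0
  rw [h_zero (by omega), v_zero (by omega)] at this
  linarith

theorem mem_Omega1 (hn : 3 ≤ n) {x y : ℝ} :
    (x, y) ∈ Omega1 n ↔ 0 < x ∧ x ≤ 1 ∧ 1 - (1 + h n 1) * x < y ∧ y ≤ 1 := by
  rw [← rowModulus_eq hn]
  rfl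

/-- The value of the linear functional `(x, y)` at the `j`-th diagonal. -/
noncomputable def value (n : ℕ) (x y : ℝ) (j : ℕ) : ℝ := x * h n j + y * v n j

theorem value_zero (hn : 3 ≤ n) (x y : ℝ) : value n x y 0 = x + y := by
  simp [value, h_zero (show 2 ≤ n by omega), v_zero (show 2 ≤ n by omega)]

theorem value_penultimate (hn : 3 ≤ n) (x y : ℝ) : value n x y (n - 2) = h n 1 * x + y := by
  rw [value, h_last hn, v_penultimate hn]
  ring

theorem value_last (hn : 3 ≤ n) (x y : ℝ) : value n x y (n - 1) = x := by
  rw [value, v_last (by omega), h_symm (j := 0) (by omega), h_zero (by omega)]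
  ring

theorem mem_P_one {x y : ℝ} (hn : 3 ≤ n) :
    (x, y) ∈ P n 1 ↔ (x, y) ∈ Omega1 n ∧ 1 < value n x y 0 := by
  rw [value_zero hn]
  simp [P]

theorem mem_P_last {x y : ℝ} (hn : 3 ≤ n) :
    (x, y) ∈ P n n ↔ (x, y) ∈ Omega1 n ∧ value n x y (n - 2) ≤ 1 := by
  rw [value_penultimate hn]
  simp [P, show n ≠ 1 by omega]

theorem mem_P_mid {x y : ℝ} (hn : 3 ≤ n) {i : ℕ} (hi : i + 3 ≤ n) :
    (x, y) ∈ P n (i + 2) ↔ (x, y) ∈ Omega1 n ∧ value n x y i ≤ 1 ∧ 1 < value n x y (i + 1) ∧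
      1 < value n x y (n - 2) := by
  rw [value_penultimate hn]
  simp only [P, if_neg (show i + 2 ≠ 1 by omega), if_neg (show i + 2 ≠ n by omega),
    mul_comm (h n 1)]
  rfl

theorem one_lt_value {x y : ℝ} {i j : ℕ} (hij : i ≤ j) (hj : j + 2 ≤ n)
    (h1 : 1 < value n x y i) (h2 : 1 < value n x y (n - 2)) : 1 < value n x y j := by
  rcases hij.eq_or_lt with rfl | hij
  · exact h1
  rcases (show j = n - 2 ∨ j < n - 2 by omega) with rfl | hj
  · exact h2
  · exact one_lt_between x y hij hj (by omega) h1.le h2.le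

theorem one_lt_value_penultimate (hn : 3 ≤ n) {x y : ℝ} (hx : 0 < x) (h : 1 < value n x y 0) :
    1 < value n x y (n - 2) := by
  rw [value_penultimate hn]
  rw [value_zero hn] at h
  nlinarith [one_le_h (show 2 ≤ n by omega) (show 1 + 1 ≤ n by omega)]

theorem index_cases (hn : 3 ≤ n) {i : ℕ} (hi : i ∈ Set.Icc 1 n) :
    i = 1 ∨ i = n ∨ ∃ j, i = j + 2 ∧ j + 3 ≤ n := by
  obtain ⟨h1, h2⟩ := hi
  by_cases h : i = 1 ∨ i = n
  · exact h.imp_right Or.inl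
  · push Not at h
    exact Or.inr (Or.inr ⟨i - 2, by omega, by omega⟩)

theorem P_subset_Omega1 (hn : 3 ≤ n) {i : ℕ} (hi : i ∈ Set.Icc 1 n) : P n i ⊆ Omega1 n := by
  rintro ⟨x, y⟩ hz
  rcases index_cases hn hi with rfl | rfl | ⟨j, rfl, hj⟩
  · exact ((mem_P_one hn).1 hz).1
  · exact ((mem_P_last hn).1 hz).1
  · exact ((mem_P_mid hn hj).1 hz).1

theorem value_le_of_mem_P (hn : 3 ≤ n) {i : ℕ} (h2 : 2 ≤ i) (hi : i ≤ n) {x y : ℝ}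
    (hz : (x, y) ∈ P n i) : value n x y (i - 2) ≤ 1 := by
  rcases index_cases hn ⟨show 1 ≤ i by omega, hi⟩ with rfl | rfl | ⟨j, rfl, hj⟩
  · omega
  · exact ((mem_P_last hn).1 hz).2
  · exact ((mem_P_mid hn hj).1 hz).2.1

theorem one_lt_value_of_mem_P (hn : 3 ≤ n) {i j : ℕ} (h1 : 1 ≤ i) (hij : i ≤ j + 1)
    (hj : j + 2 ≤ n) {x y : ℝ} (hz : (x, y) ∈ P n i) : 1 < value n x y j := by
  rcases index_cases hn ⟨h1, show i ≤ n by omega⟩ with rfl | rfl | ⟨k, rfl, hk⟩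
  · obtain ⟨hO, hgt⟩ := (mem_P_one hn).1 hz
    exact one_lt_value (Nat.zero_le j) hj hgt (one_lt_value_penultimate hn hO.1 hgt)
  · omega
  · obtain ⟨-, -, hgt, hlast⟩ := (mem_P_mid hn hk).1 hz
    exact one_lt_value (by omega) hj hgt hlast

theorem disjoint_P (hn : 3 ≤ n) : (Set.Icc 1 n).PairwiseDisjoint (P n) := by
  have key (i j : ℕ) (hi : 1 ≤ i) (hj : j ≤ n) (hij : i < j) : Disjoint (P n i) (P n j) := by
    rw [Set.disjoint_left]
    rintro ⟨x, y⟩ hzi hzj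
    exact (value_le_of_mem_P hn (by omega) hj hzj).not_gt
      (one_lt_value_of_mem_P hn hi (by omega) (by omega) hzi)
  intro i hi j hj hij
  rcases hij.lt_or_gt with h | h
  · exact key i j hi.1 hj.2 h
  · exact (key j i hj.1 hi.2 h).symm

theorem iUnion_P (hn : 3 ≤ n) : (⋃ i ∈ Set.Icc 1 n, P n i) = Omega1 n := by
  apply Set.Subset.antisymm
  · exact Set.iUnion₂_subset fun i hi => P_subset_Omega1 hn hi
  · rintro ⟨x, y⟩ hz
    rw [Set.mem_iUnion₂]
    by_cases hlast : value n x y (n - 2) ≤ 1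
    · exact ⟨n, ⟨by omega, le_rfl⟩, (mem_P_last hn).2 ⟨hz, hlast⟩⟩
    push Not at hlast
    -- The least such index determines the region.
    have hex : ∃ k, 1 < value n x y k := ⟨_, hlast⟩
    classical
    have hspec := Nat.find_spec hex
    have hle : Nat.find hex ≤ n - 2 := Nat.find_min' hex hlast
    rcases hz' : Nat.find hex with _ | k
    · rw [hz'] at hspec
      exact ⟨1, ⟨le_rfl, by omega⟩, (mem_P_one hn).2 ⟨hz, hspec⟩⟩
    · have hk := not_lt.1 (Nat.find_min hex (m := k) (by omega))
      rw [hz'] at hspec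
      exact ⟨k + 2, ⟨by omega, by omega⟩, (mem_P_mid hn (by omega)).2 ⟨hz, hk, hspec, hlast⟩⟩

theorem nonempty_P (hn : 3 ≤ n) {i : ℕ} (hi : i ∈ Set.Icc 1 n) : (P n i).Nonempty := by
  have hh1 := one_le_h (show 2 ≤ n by omega) (show 1 + 1 ≤ n by omega)
  rcases index_cases hn hi with rfl | rfl | ⟨j, rfl, hj⟩
  · refine ⟨(1, 1), (mem_P_one hn).2 ⟨(mem_Omega1 hn).2 ⟨one_pos, le_rfl, ?_, le_rfl⟩, ?_⟩⟩
    · linarith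
    · rw [value_zero hn]
      norm_num
  · refine ⟨(1, 1 - h i 1), (mem_P_last hn).2
      ⟨(mem_Omega1 hn).2 ⟨one_pos, le_rfl, ?_, ?_⟩, ?_⟩⟩
    · linarith
    · linarith
    · rw [value_penultimate hn]
      linarith
  · have hv := one_le_v (show j + 2 ≤ n by omega)
    have hh := one_le_h (show 2 ≤ n by omega) (show j + 1 ≤ n by omega)
    -- With x = 1 this makes the functional equal to one at both d_j and d_{n-1}, hence larger
    -- strictly between.
    set y := (1 - h n j) / v n j with hy
    have hval : value n 1 y j = 1 := by
      rw [value, hy, div_mul_cancel₀ _ (by linarith)]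
      ring
    have hbetween (k : ℕ) (h1 : j < k) (h2 : k < n - 1) : 1 < value n 1 y k :=
      one_lt_between 1 y h1 h2 (by omega) hval.ge (value_last hn 1 y).ge
    have hlast := hbetween (n - 2) (by omega) (by omega)
    refine ⟨(1, y), (mem_P_mid hn hj).2 ⟨(mem_Omega1 hn).2 ⟨one_pos, le_rfl, ?_, ?_⟩, hval.le,
      hbetween (j + 1) (by omega) (by omega), hlast⟩⟩
    · rw [value_penultimate hn] at hlast
      linarith
    · have : y ≤ 0 := div_nonpos_of_nonpos_of_nonneg (by linarith) (by linarith)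
      linarith

theorem convex_setOf_value_le (j : ℕ) : Convex ℝ {z : ℝ × ℝ | value n z.1 z.2 j ≤ 1} :=
  convex_halfSpace_le ⟨fun z w => by simp [value]; ring, fun c z => by simp [value]; ring⟩ 1

theorem convex_setOf_lt_value (j : ℕ) : Convex ℝ {z : ℝ × ℝ | 1 < value n z.1 z.2 j} :=
  convex_halfSpace_gt ⟨fun z w => by simp [value]; ring, fun c z => by simp [value]; ring⟩ 1

theorem convex_Omega1 (n : ℕ) : Convex ℝ (Omega1 n) := by
  have e : Omega1 n = {z : ℝ × ℝ | 0 < z.1} ∩ {z | z.1 ≤ 1} ∩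
      {z | 1 < rowModulus n * z.1 + z.2} ∩ {z | z.2 ≤ 1} := by
    ext z
    simp only [Omega1, rowModulus, Set.mem_inter_iff, Set.mem_ofPred_eq, and_assoc,
      sub_lt_iff_lt_add']
  rw [e]
  exact (((convex_halfSpace_gt ⟨fun _ _ => rfl, fun _ _ => rfl⟩ 0).inter
    (convex_halfSpace_le ⟨fun _ _ => rfl, fun _ _ => rfl⟩ 1)).inter
    (convex_halfSpace_gt ⟨fun z w => by simp; ring, fun c z => by simp; ring⟩ 1)).inter
    (convex_halfSpace_le ⟨fun _ _ => rfl, fun _ _ => rfl⟩ 1)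

theorem convex_P (hn : 3 ≤ n) {i : ℕ} (hi : i ∈ Set.Icc 1 n) : Convex ℝ (P n i) := by
  rcases index_cases hn hi with rfl | rfl | ⟨j, rfl, hj⟩
  · rw [show P n 1 = Omega1 n ∩ {z | 1 < value n z.1 z.2 0} from Set.ext fun z => mem_P_one hn]
    exact (convex_Omega1 n).inter (convex_setOf_lt_value 0)
  · rw [show P i i = Omega1 i ∩ {z | value i z.1 z.2 (i - 2) ≤ 1} from
      Set.ext fun z => mem_P_last hn]
    exact (convex_Omega1 i).inter (convex_setOf_value_le (i - 2))
  · rw [show P n (j + 2) = Omega1 n ∩ ({z | value n z.1 z.2 j ≤ 1} ∩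
      ({z | 1 < value n z.1 z.2 (j + 1)} ∩ {z | 1 < value n z.1 z.2 (n - 2)})) from
      Set.ext fun z => mem_P_mid hn hj]
    exact (convex_Omega1 n).inter ((convex_setOf_value_le j).inter
      ((convex_setOf_lt_value (j + 1)).inter (convex_setOf_lt_value (n - 2))))

/-! ### The winners in each region -/

theorem one_lt_value_penultimate_add (hn : 3 ≤ n) {x y : ℝ} (hz : (x, y) ∈ Omega1 n) :
    1 < value n x y (n - 2) + x := by
  rw [value_penultimate hn]
  linarith [((mem_Omega1 hn).1 hz).2.2.1]

/-- Interpolate d_{i+1} between d_i and d_{n-1}: its value exceeds one while that at d_{n-1} is x ≤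
1, and its weight is at least that of d_{n-1}, so d_i must contribute positively. -/
theorem value_pos {x y : ℝ} (hx1 : x ≤ 1) {i : ℕ} (hi : i + 3 ≤ n)
    (h1 : 1 < value n x y (i + 1)) : 0 < value n x y i := by
  obtain ⟨m, rfl⟩ := Nat.exists_eq_add_of_le hi
  have hn : 2 ≤ i + 3 + m := by omega
  have key := sin_interpolation hn x y i 1 (m + 1)
  have hlast := value_last (show 3 ≤ i + 3 + m by omega) x y
  rw [show i + 3 + m - 1 = i + 1 + (m + 1) by omega] at hlast
  have hs := sin_mul_pi_div_pos (n := i + 3 + m) (p := m + 1) (by omega) (by omega)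
  have hs1 := sin_mul_eq_v hn (m + 1)
  have hv := one_le_v (n := i + 3 + m) (j := m + 1) (by omega)
  have hp := sin_pi_div_pos hn
  rw [← Nat.cast_add, show 1 + (m + 1) = m + 1 + 1 by omega, hs1, ← value, ← value, ← value,
    hlast, Nat.cast_one, one_mul] at key
  generalize Real.sin (Real.pi / _) = s at *
  have h2 : s * x < v (i + 3 + m) (m + 1) * s * value (i + 3 + m) x y (i + 1) := by
    have := mul_pos (show 0 < v (i + 3 + m) (m + 1) by linarith) hp
    nlinarith
  by_contra! hneg
  nlinarith

theorem isWinner_P_succ (hn : 3 ≤ n) {i : ℕ} (hi : i + 2 ≤ n) {x y : ℝ} (hx : 0 < x)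
    (hz : (x, y) ∈ P n (i + 2)) :
    IsWinner n (M x y hx) ![h n i, v n i] ∧
      IsReturnTime n (M x y hx) (v n i / (x * (h n i * x + v n i * y))) := by
  have hO := P_subset_Omega1 hn ⟨show 1 ≤ i + 2 by omega, hi⟩ hz
  have hx1 := hO.2.1
  have hpos : 0 < value n x y i := by
    rcases hi.eq_or_lt with h | h
    · have := one_lt_value_penultimate_add hn hO
      rw [show n - 2 = i by omega] at this
      linarith
    · exact value_pos hx1 h (one_lt_value_of_mem_P hn (by omega) le_rfl h hz)
  refine isWinner_and_isReturnTime (by omega) hx hx1 (hv_mem hi)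
    (one_pos.trans_le (one_le_v hi)) hpos (value_le_of_mem_P hn (by omega) hi hz) ?_
  intro a b hw hb hcw
  exact one_lt_of_clockwise (by omega) hi hx hpos
    (fun j hij hj => one_lt_value_of_mem_P hn (by omega) (by omega) hj hz)
    (one_lt_value_penultimate_add hn hO) hw hb hcw

theorem isWinner_P_one (hn : 3 ≤ n) {x y : ℝ} (hx : 0 < x) (hz : (x, y) ∈ P n 1) :
    IsWinner n (M x y hx) ![0, 1] ∧ IsReturnTime n (M x y hx) (1 / (x * y)) := by
  obtain ⟨hO, hgt⟩ := (mem_P_one hn).1 hz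
  have hx1 := hO.2.1
  have hxy : 1 < x + y := by rwa [value_zero hn] at hgt
  have key := isWinner_and_isReturnTime (n := n) (p := 0) (q := 1) (y := y) (by omega) hx hx1
    (vertical_mem (by omega)) one_pos (by linarith) (by simpa using hO.2.2.2) ?_
  · simpa using key
  intro a b hw hb ha
  simp only [mul_one, mul_zero, sub_zero] at ha
  -- Beyond (1, 1) the cone argument applies. Between (0, 1) and (1, 1), a ≥ 1 and ℓ(a, b) ≥ (x +
  -- y)a > 1, as y > 0.
  rcases lt_or_ge b a with hab | hab
  · refine one_lt_of_clockwise (i := 0) (by omega) (by omega) hx (one_pos.trans hgt)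
      (fun j hij hj => one_lt_value_of_mem_P hn le_rfl (by omega) hj hz)
      (one_lt_value_penultimate_add hn hO) hw hb ?_
    rw [h_zero (by omega), v_zero (by omega)]
    linarith
  · have ha1 : 1 ≤ |a| := one_le_abs_of_mem hw (k := 0) ha.ne'
    rw [abs_of_pos ha] at ha1
    nlinarith [mul_nonneg (sub_nonneg.2 hab) (show 0 ≤ y by linarith)]

end Staircase

theorem mainTheorem4 (n : ℕ) (hn : 3 ≤ n) :
    -- `P_1, …, P_n` are convex and nonempty, and they partition `Ω₁`
    ((⋃ i ∈ Set.Icc 1 n, Staircase.P n i) = Staircase.Omega1 n ∧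
      (Set.Icc 1 n).PairwiseDisjoint (Staircase.P n) ∧
      ∀ i ∈ Set.Icc 1 n, Convex ℝ (Staircase.P n i) ∧ (Staircase.P n i).Nonempty) ∧
    -- the region `P_1`
    ((∃ h0 : 0 < n / 2, ![0, 1] = (Staircase.Tile.V 0 h0 : Staircase.Tile n).verticalEdge) ∧
      ∀ (x y : ℝ) (hx : 0 < x), (x, y) ∈ Staircase.P n 1 →
        Staircase.IsWinner n (Staircase.M x y hx) ![0, 1] ∧
        Staircase.IsReturnTime n (Staircase.M x y hx) (1 / (x * y))) ∧
    -- the regions `P_i` with `2 ≤ i ≤ n - 1`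
    (∀ i : ℕ, 2 ≤ i → i ≤ n - 1 →
      (![Staircase.h n (i - 2), Staircase.v n (i - 2)] : Fin 2 → ℝ) =
        ![Staircase.h n (n + 1 - i), Staircase.v n (n - i)] ∧
      (i ≤ n / 2 + 1 → ∃ hi : i - 2 < n / 2,
        ![Staircase.h n (i - 2), Staircase.v n (i - 2)] =
          (Staircase.Tile.V (i - 2) hi : Staircase.Tile n).diagonal) ∧
      (n / 2 + 2 ≤ i → ∃ hi : 1 ≤ n + 1 - i ∧ n + 1 - i < (n + 1) / 2,
        ![Staircase.h n (i - 2), Staircase.v n (i - 2)] =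
          (Staircase.Tile.H (n + 1 - i) hi : Staircase.Tile n).diagonal) ∧
      ∀ (x y : ℝ) (hx : 0 < x), (x, y) ∈ Staircase.P n i →
        Staircase.IsWinner n (Staircase.M x y hx)
          ![Staircase.h n (i - 2), Staircase.v n (i - 2)] ∧
        Staircase.IsReturnTime n (Staircase.M x y hx)
          (Staircase.v n (i - 2) /
            (x * (Staircase.h n (i - 2) * x + Staircase.v n (i - 2) * y)))) ∧
    -- the region `P_n`
    ((∃ h1 : 1 ≤ 1 ∧ 1 < (n + 1) / 2, ![Staircase.h n 1, Staircase.v n 0] =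
        (Staircase.Tile.H 1 h1 : Staircase.Tile n).diagonal) ∧
      ∀ (x y : ℝ) (hx : 0 < x), (x, y) ∈ Staircase.P n n →
        Staircase.IsWinner n (Staircase.M x y hx) ![Staircase.h n 1, Staircase.v n 0] ∧
        Staircase.IsReturnTime n (Staircase.M x y hx)
          (Staircase.v n 0 / (x * (Staircase.h n 1 * x + Staircase.v n 0 * y)))) := by
  have h2 : 2 ≤ n := by omega
  refine ⟨⟨Staircase.iUnion_P hn, Staircase.disjoint_P hn,
    fun i hi => ⟨Staircase.convex_P hn hi, Staircase.nonempty_P hn hi⟩⟩,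
    ⟨⟨by omega, ?_⟩, fun x y hx hz => Staircase.isWinner_P_one hn hx hz⟩, fun i hi hin => ?_,
    ⟨⟨le_rfl, by omega⟩, ?_⟩, fun x y hx hz => ?_⟩
  · simp [Staircase.Tile.verticalEdge, Staircase.Tile.height, Staircase.v_zero h2]
  · obtain ⟨j, rfl⟩ := Nat.exists_eq_add_of_le' hi
    rw [Nat.add_sub_cancel]
    have hsymm : (![Staircase.h n j, Staircase.v n j] : Fin 2 → ℝ) =
        ![Staircase.h n (n + 1 - (j + 2)), Staircase.v n (n + 1 - (j + 2) - 1)] :=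
      Staircase.hv_symm (by omega) (by omega)
    refine ⟨?_, fun hj => ⟨by omega, rfl⟩, fun hj => ⟨by omega, hsymm⟩,
      fun x y hx hz => Staircase.isWinner_P_succ hn (by omega) hx hz⟩
    rw [hsymm, show n + 1 - (j + 2) - 1 = n - (j + 2) by omega]
  · rfl
  -- The last region follows the same pattern, with winner d_{n-2} = (h_1, v_0).
  · have hz' : (x, y) ∈ Staircase.P n (n - 2 + 2) := by rwa [Nat.sub_add_cancel h2]
    have key := Staircase.isWinner_P_succ hn (by omega) hx hz'
    rw [Staircase.h_last hn, Staircase.v_penultimate hn] at key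
    rwa [Staircase.v_zero h2]
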